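/- **Setting.** Let $\Sigma$ be an alphabet and $\mathsf P_\Sigma=\{(_a,\,)_a : a\in\Sigma\}$. A *forest* over $\Sigma$ is a balanced string over $\mathsf P_\Sigma$: forests form the smallest set of strings that contains the empty string $\varepsilon$ and is closed under concatenation and under $F\mapsto (_a\,F\,)_a$ for $a\in\Sigma$. $|F|$ is the length of the string; in a forest every parenthesis has a unique mate. A *weight function* is a map $w:(\Sigma\cup\{\varepsilon\})^2\to\mathbb R_{\ge0}$; it is *normalized* if $w(a,a)=0$ and $w(a,b)\ge1$ for $a\ne b$, and a *quasimetric* if it satisfies $w(a,c)\le w(a,b)+w(b,c)$. An *alignment* of $F$ onto $G$ is a path from $(0,0)$ to $(|F|,|G|)$ with edges $(x,y)\to(x+1,y)$ (deletion of $F[x]$), $(x,y)\to(x,y+1)$ (insertion of $G[y]$), $(x,y)\to(x+1,y+1)$ ($F[x]$ is aligned to $G[y]$). It is a *forest alignment* if, whenever $F[x]$ is aligned to $G[y]$, the mate of $F[x]$ is aligned to the mate of $G[y]$. An edge costs half of the weight $w$ of the labels involved (with $\varepsilon$ for the missing character in a deletion or an insertion), $\mathsf{ted}^w(F,G)$ is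 the minimum total cost of a forest alignment of $F$ onto $G$, and $\mathsf{ted}^w_{\le k}(F,G)$ is $\mathsf{ted}^w(F,G)$ if this is at most $k$, and $\infty$ otherwise. Forests $P,P'$ are *$\mathsf{ted}^w_{\le k}$-equivalent* if $\mathsf{ted}^w_{\le k}(F_1PF_2,\,G_1PG_2)=\mathsf{ted}^w_{\le k}(F_1P'F_2,\,G_1P'G_2)$ for all strings $F_1,F_2,G_1,G_2$ over $\mathsf P_\Sigma$ such that $F_1PF_2$ and $G_1PG_2$ are forests and $\bigl||F_1|-|G_1|\bigr|\le 2k$. Let $k\ge1$ be an integer. A string $S$ over $\mathsf P_\Sigma$ is a *periodic block* if $|S|\ge42k$ and $S$ has a period $p$ with $1\le p\le4k$ such that $S[0..p)$ has equally many opening and closing parentheses. A character $T[i]$ of a string $T$ is *black* if there is a fragment $T[l..r)$ that is a periodic block with $l+5k\le i<r-5k$; the other characters are *red*, and $\mathrm{red}_k(T)$ is the set of red characters of $T$. **Lemma.** (a) There is a linear-time algorithm that, given a forest $P$ and an integer $k\ge1$, computes a forest $P'$ with $|P'|\le|P|$ and $|\mathrm{red}_k(P')|\le158k^2$, all of whose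 labels occur in $P$, such that $P$ and $P'$ are $\mathsf{ted}^w_{\le k}$-equivalent for every normalized quasimetric $w$. Here *linear-time* means: a fixed word-RAM program (arithmetic operations $+$, $\times$ and subtraction truncated at $0$, arrays with indirect addressing, zero tests, unit cost) takes at most $C\cdot(|P|+1)$ steps for an absolute constant $C$, where distinct labels occurring in $P$ are represented by distinct natural numbers, and words of $O(\log M)$ bits suffice whenever $M\ge2$ bounds $|P|$, $k$ and these numbers. (b) For every integer $k\ge1$, any two forests $P,P'$ with $|\mathrm{red}_k(P)|\ge158k^2$ and $|\mathrm{red}_k(P')|\ge158k^2$ are $\mathsf{ted}^w_{\le k}$-equivalent for every normalized quasimetric $w$. -/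

import Mathlib

open scoped NNReal ENNReal

namespace TedKernel

universe u

/-! ### Parentheses, forests, nodes -/

/-- A parenthesis with a label in `α`: `⟨true, a⟩` is the opening and `⟨false, a⟩` the closing
parenthesis with label `a`. Strings of parentheses are lists `List (Paren α)`. -/
structure Paren (α : Type u) where
  isOpen : Bool
  label : α

/-- Forests with labels in `α`, identified with balanced strings of parentheses. -/
inductive IsForest {α : Type u} : List (Paren α) → Prop
  | nil : IsForest []
  | append {F G : List (Paren α)} (hF : IsForest F) (hG : IsForest G) : IsForest (F ++ G)
  | node {F : List (Paren α)} (a : α) (hF : IsForest F) :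
      IsForest (⟨true, a⟩ :: (F ++ [⟨false, a⟩]))

/-- The fragment `T[l .. r)`. -/
def fragment {β : Type u} (T : List β) (l r : ℕ) : List β := (T.take r).drop l

/-- `[i .. j]` is a node of `F`: `F[i]` is an opening parenthesis, `F[j]` is a closing one, and
the string strictly between them is balanced. -/
def IsNode {α : Type u} (F : List (Paren α)) (i j : ℕ) : Prop :=
  i < j ∧ (∃ a, F[i]? = some ⟨true, a⟩) ∧ (∃ a, F[j]? = some ⟨false, a⟩) ∧
    IsForest (fragment F (i + 1) j)

/-- The parentheses at positions `i` and `j` of `F` are paired with each other. -/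
def IsMate {α : Type u} (F : List (Paren α)) (i j : ℕ) : Prop := IsNode F i j ∨ IsNode F j i

/-! ### Weight functions and tree edit distance. `none : Option α` is the empty string `ε`. -/

/-- `w` is normalized: `w a a = 0`, and `w a b ≥ 1` for distinct `a`, `b`. -/
def Normalized {α : Type u} (w : Option α → Option α → ℝ≥0) : Prop :=
  (∀ a, w a a = 0) ∧ ∀ a b, a ≠ b → 1 ≤ w a b

/-- `w` satisfies the triangle inequality. -/
def IsQuasimetric {α : Type u} (w : Option α → Option α → ℝ≥0) : Prop :=
  ∀ a b c, w a c ≤ w a b + w b c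

/-- The edges of the alignment graph of strings of lengths `m` and `n`. -/
def AlignEdge (m n : ℕ) (p q : ℕ × ℕ) : Prop :=
  (q = (p.1 + 1, p.2) ∧ p.1 < m ∧ p.2 ≤ n) ∨
  (q = (p.1, p.2 + 1) ∧ p.1 ≤ m ∧ p.2 < n) ∨
  (q = (p.1 + 1, p.2 + 1) ∧ p.1 < m ∧ p.2 < n)

/-- An alignment of the whole string `X` onto the whole string `Y`: a path from `(0, 0)` to
`(|X|, |Y|)` in the alignment graph, as the sequence of its vertices. -/
structure IsAlignment {α : Type u} (X Y : List (Paren α)) (A : List (ℕ × ℕ)) : Prop where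
  head : A.head? = some (0, 0)
  last : A.getLast? = some (X.length, Y.length)
  chain : A.IsChain (AlignEdge X.length Y.length)

/-- `A` aligns the `x`-th character of the first string to the `y`-th one of the second string. -/
def Aligns (A : List (ℕ × ℕ)) (x y : ℕ) : Prop := [(x, y), (x + 1, y + 1)] <:+: A

/-- Forest alignments: if two characters are aligned, then so are their mates. -/
def IsForestAlignment {α : Type u} (F G : List (Paren α)) (A : List (ℕ × ℕ)) : Prop :=
  IsAlignment F G A ∧
    ∀ f g f' g', Aligns A f g → IsMate F f f' → IsMate G g g' → Aligns A f' g'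

/-- Half the weight of the labels, for parentheses or the empty string. -/
noncomputable def halfWeight {α : Type u} (w : Option α → Option α → ℝ≥0)
    (p q : Option (Paren α)) : ℝ≥0 :=
  w (p.map Paren.label) (q.map Paren.label) / 2

/-- The cost of the edge from `p` to `q`: the character of `X` consumed by the edge (or `ε`)
against the character of `Y` consumed by the edge (or `ε`). -/
noncomputable def edgeCost {α : Type u} (w : Option α → Option α → ℝ≥0) (X Y : List (Paren α))
    (p q : ℕ × ℕ) : ℝ≥0 :=
  halfWeight w (if q.1 = p.1 + 1 then X[p.1]? else none) (if q.2 = p.2 + 1 then Y[p.2]? else none)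

/-- The cost of an alignment: the total cost of its edges. -/
noncomputable def alignmentCost {α : Type u} (w : Option α → Option α → ℝ≥0)
    (X Y : List (Paren α)) (A : List (ℕ × ℕ)) : ℝ≥0 :=
  (List.zipWith (edgeCost w X Y) A A.tail).sum

/-- Tree edit distance: the minimum cost of a forest alignment. -/
noncomputable def ted {α : Type u} (w : Option α → Option α → ℝ≥0) (F G : List (Paren α)) :
    ℝ≥0∞ :=
  ⨅ (A : List (ℕ × ℕ)) (_ : IsForestAlignment F G A), (alignmentCost w F G A : ℝ≥0∞)

open Classical in
/-- Tree edit distance capped at the threshold `k`. -/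
noncomputable def tedLe {α : Type u} (k : ℕ) (w : Option α → Option α → ℝ≥0)
    (F G : List (Paren α)) : ℝ≥0∞ :=
  if ted w F G ≤ k then ted w F G else ⊤

/-- `P` and `P'` are `ted_{≤k}^w`-equivalent: replacing an occurrence of `P` in `F` and one in `G`,
at positions that differ by at most `2k`, by `P'` does not change the capped distance. -/
def TedEquivalent {α : Type u} (k : ℕ) (w : Option α → Option α → ℝ≥0)
    (P P' : List (Paren α)) : Prop :=
  ∀ F₁ F₂ G₁ G₂ : List (Paren α),
    IsForest (F₁ ++ P ++ F₂) → IsForest (G₁ ++ P ++ G₂) →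
    F₁.length ≤ G₁.length + 2 * k → G₁.length ≤ F₁.length + 2 * k →
    tedLe k w (F₁ ++ P ++ F₂) (G₁ ++ P ++ G₂) = tedLe k w (F₁ ++ P' ++ F₂) (G₁ ++ P' ++ G₂)

/-! ### Periodic blocks, black and red characters -/

/-- `S` has period `p`, that is, string period `S[0 .. p)`. -/
def HasPeriod {β : Type u} (S : List β) (p : ℕ) : Prop :=
  1 ≤ p ∧ p ≤ S.length ∧ ∀ i, i + p < S.length → S[i]? = S[i + p]?

/-- Equally many opening and closing parentheses. -/
def EquallyMany {α : Type u} (Q : List (Paren α)) : Prop :=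
  Q.countP (fun c => c.isOpen) = Q.countP (fun c => !c.isOpen)

/-- Periodic blocks for the threshold `k`. -/
def IsPeriodicBlock {α : Type u} (k : ℕ) (S : List (Paren α)) : Prop :=
  42 * k ≤ S.length ∧ ∃ p, p ≤ 4 * k ∧ HasPeriod S p ∧ EquallyMany (S.take p)

/-- The character `T[i]` is black. -/
def IsBlack {α : Type u} (k : ℕ) (T : List (Paren α)) (i : ℕ) : Prop :=
  ∃ l r, l ≤ r ∧ r ≤ T.length ∧ IsPeriodicBlock k (fragment T l r) ∧ l + 5 * k ≤ i ∧ i + 5 * k < r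

open Classical in
/-- The set of (positions of) red characters of `T`. -/
noncomputable def red {α : Type u} (k : ℕ) (T : List (Paren α)) : Finset ℕ :=
  (Finset.range T.length).filter (fun i => ¬ IsBlack k T i)

/-! ### Machine model: structured programs for a word RAM

A program has finitely many variables and arrays, each named by a number, and works on natural
numbers smaller than a bound `W` (the number of different machine words). Every arithmetic
operation, memory access, assignment and test takes one unit of time. -/

/-- The memory: the contents of the variables and of the arrays. -/
structure Memory where
  var : ℕ → ℕ
  arr : ℕ → ℕ → ℕ

/-- Expressions. The subtraction is truncated at zero. -/
inductive Ex
  | const (n : ℕ)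
  | var (x : ℕ)
  | read (a : ℕ) (i : Ex)
  | add (e f : Ex)
  | sub (e f : Ex)
  | mul (e f : Ex)

/-- The value of an expression. -/
def Ex.val (s : Memory) : Ex → ℕ
  | .const n => n
  | .var x => s.var x
  | .read a i => s.arr a (i.val s)
  | .add e f => e.val s + f.val s
  | .sub e f => e.val s - f.val s
  | .mul e f => e.val s * f.val s

/-- All values that occur in the evaluation of an expression fit into a machine word. -/
def Ex.Fits (W : ℕ) (s : Memory) : Ex → Prop
  | .const n => n < W
  | .var x => s.var x < W
  | .read a i => i.Fits W s ∧ s.arr a (i.val s) < W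
  | .add e f => e.Fits W s ∧ f.Fits W s ∧ e.val s + f.val s < W
  | .sub e f => e.Fits W s ∧ f.Fits W s
  | .mul e f => e.Fits W s ∧ f.Fits W s ∧ e.val s * f.val s < W

/-- The time for evaluating an expression: the number of its constants, variables, memory accesses
and operations. -/
def Ex.time : Ex → ℕ
  | .const _ => 1
  | .var _ => 1
  | .read _ i => i.time + 1
  | .add e f => e.time + f.time + 1
  | .sub e f => e.time + f.time + 1
  | .mul e f => e.time + f.time + 1

/-- Programs. -/
inductive Prog
  | skip
  | assign (x : ℕ) (e : Ex)
  | write (a : ℕ) (i e : Ex)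
  | seq (c d : Prog)
  | ite (e : Ex) (c d : Prog)
  | while (e : Ex) (c : Prog)

/-- Assign the value `v` to the variable `x`. -/
def Memory.setVar (s : Memory) (x v : ℕ) : Memory :=
  { s with var := Function.update s.var x v }

/-- Write the value `v` to the cell `i` of the array `a`. -/
def Memory.setArr (s : Memory) (a i v : ℕ) : Memory :=
  { s with arr := Function.update s.arr a (Function.update (s.arr a) i v) }

/-- `Exec W c s t s'`: with words smaller than `W`, the program `c`, started with memory `s`, halts
after exactly `t` units of time with memory `s'`. Tests ask whether a value is nonzero. -/
inductive Exec (W : ℕ) : Prog → Memory → ℕ → Memory → Prop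
  | skip (s : Memory) : Exec W .skip s 1 s
  | assign (s : Memory) (x : ℕ) (e : Ex) (he : e.Fits W s) :
      Exec W (.assign x e) s (e.time + 1) (s.setVar x (e.val s))
  | write (s : Memory) (a : ℕ) (i e : Ex) (hi : i.Fits W s) (he : e.Fits W s) :
      Exec W (.write a i e) s (i.time + e.time + 1) (s.setArr a (i.val s) (e.val s))
  | seq {c d : Prog} {s s₁ s₂ : Memory} {t₁ t₂ : ℕ}
      (hc : Exec W c s t₁ s₁) (hd : Exec W d s₁ t₂ s₂) : Exec W (.seq c d) s (t₁ + t₂) s₂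
  | ite_true {e : Ex} {c d : Prog} {s s₁ : Memory} {t : ℕ}
      (he : e.Fits W s) (h : e.val s ≠ 0) (hc : Exec W c s t s₁) :
      Exec W (.ite e c d) s (e.time + t + 1) s₁
  | ite_false {e : Ex} {c d : Prog} {s s₁ : Memory} {t : ℕ}
      (he : e.Fits W s) (h : e.val s = 0) (hd : Exec W d s t s₁) :
      Exec W (.ite e c d) s (e.time + t + 1) s₁
  | while_false {e : Ex} {c : Prog} {s : Memory}
      (he : e.Fits W s) (h : e.val s = 0) : Exec W (.while e c) s (e.time + 1) s
  | while_true {e : Ex} {c : Prog} {s s₁ s₂ : Memory} {t₁ t₂ : ℕ}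
      (he : e.Fits W s) (h : e.val s ≠ 0) (hc : Exec W c s t₁ s₁)
      (hw : Exec W (.while e c) s₁ t₂ s₂) : Exec W (.while e c) s (e.time + t₁ + t₂ + 1) s₂

/-- The memory on start: variables `0` and `1` hold `|P|` and `k`, array `0` holds the labels of
the characters of `P` (as numbers), array `1` tells which of them are opening parentheses (`1`) and
which are closing ones (`0`); all other cells hold `0`. -/
def inputMemory {α : Type u} (code : α → ℕ) (P : List (Paren α)) (k : ℕ) : Memory where
  var := fun x => if x = 0 then P.length else if x = 1 then k else 0
  arr := fun a i =>
    if a = 0 then (P[i]?).elim 0 (fun c => code c.label)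
    else if a = 1 then (P[i]?).elim 0 (fun c => c.isOpen.toNat)
    else 0

/-- The string `P'` is the output: variable `2` holds `|P'|`, and arrays `2` and `3` hold the labels
and the kinds of the characters of `P'`. -/
def IsOutput {α : Type u} (code : α → ℕ) (P' : List (Paren α)) (s : Memory) : Prop :=
  s.var 2 = P'.length ∧
    ∀ (i : ℕ) (hi : i < P'.length),
      s.arr 2 i = code P'[i].label ∧ s.arr 3 i = P'[i].isOpen.toNat

/-- The program `c` on input `(P, k)` halts with output `P'` after at most `C · (|P| + 1)` units of
time, on every machine with `(M + 2) ^ C` different words, where `M` bounds `|P|`, `k`, and the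
numbers that represent the labels in `P` (so words of `O(log M)` bits suffice). -/
def ComputesInLinearTime {α : Type u} (c : Prog) (C : ℕ) (code : α → ℕ) (P : List (Paren α))
    (k : ℕ) (P' : List (Paren α)) : Prop :=
  ∀ M : ℕ, P.length ≤ M → k ≤ M → (∀ x ∈ P, code x.label ≤ M) →
    ∃ (t : ℕ) (s : Memory), t ≤ C * (P.length + 1) ∧
      Exec ((M + 2) ^ C) c (inputMemory code P k) t s ∧ IsOutput code P' s

end TedKernel

/-! The proof rests on a property of `P` alone, `ForcesDiagonal k P`: a forest alignment of cost
below `k + 1/2` between `F₁PF₂` and `G₁PG₂`, with the two copies of `P` shifted by at most `2k`,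
meets the main diagonal of these copies. By the triangle inequality, an alignment through such a
point can be rerouted through both corners of the square spanned by the two copies, at no higher
cost and without new aligned pairs outside. Between the corners, the free diagonal of any other
forest `P'` can be used (`Walk.replace`). As `P` and `P'` are balanced, mates of outside characters
lie outside and the result is again a forest alignment. Hence any two forests that force the
diagonal are equivalent (`ForcesDiagonal.tedEquivalent`).

It suffices for this property that `P` begins with `2k + 1` consecutive phrases, i.e. fragments
without a short balanced period (`Phrases.forcesDiagonal`). Some phrase costs less than `1/2`, so it
is copied verbatim with a shift `d`, where `|d| ≤ 4k`: `2k` from the offset of the copies and `2k`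
from earlier edits. If `d = 0`, the diagonal is met. Otherwise the phrase has period `|d|`, which
must occur at least twice and be unbalanced. Then two characters at distance `|d|` have mates in the
reverse order (`exists_crossing_mates`). The alignment pairs the two characters on one side of the
diagonal, hence their mates on the other side, and has to meet the diagonal in between.

Conversely, a fragment with a short balanced period has at most `42k` red characters, since inside a
periodic block only the ends can be red. Cutting off phrases greedily thus yields `2k + 1` phrases
whenever there are `158k²` red characters, which is (b).

For (a), the phrases are counted by a greedy scan. With more than `2k` phrases the output is a tower
of height `79k²`: it has length `158k²` and forces the diagonal because its height only rises in the
first half. Otherwise `P` has few red characters and is its own kernel. The scan is linear: a border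
table handles the first `8k` characters of a phrase, and beyond them a single candidate period is
enough. Two periods of length at most `4k` on `8k` characters have proportional height changes
(`PeriodicOn.height_proportional`) and the same continuation, so if the candidate is unbalanced or
breaks, no short balanced period is left. -/

namespace TedKernel

/-! ### Heights, mates, and removal of balanced factors -/

/-- The number of opening parentheses among the first `x` characters. -/
def openCount {α : Type*} (P : List (Paren α)) (x : ℕ) : ℕ := (P.take x).countP (fun c => c.isOpen)

/-- The height of the string after `x` characters: openings minus closings. -/
def height {α : Type*} (P : List (Paren α)) (x : ℕ) : ℤ := 2 * openCount P x - x

section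
variable {α : Type*}

theorem openCount_succ {P : List (Paren α)} {x : ℕ} {c : Paren α} (h : P[x]? = some c) :
    openCount P (x + 1) = openCount P x + c.isOpen.toNat := by
  simp only [openCount, List.take_add_one, h, Option.toList_some, List.countP_append,
    List.countP_singleton]
  cases c.isOpen <;> simp

theorem openCount_le (P : List (Paren α)) (x : ℕ) : openCount P x ≤ x :=
  (List.countP_le_length).trans (by simp)

theorem height_zero (P : List (Paren α)) : height P 0 = 0 := by simp [height, openCount]

theorem height_succ_open {P : List (Paren α)} {x : ℕ} {a : α} (h : P[x]? = some ⟨true, a⟩) :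
    height P (x + 1) = height P x + 1 := by
  simp only [height, openCount_succ h, Bool.toNat_true]; push_cast; ring

theorem height_succ_close {P : List (Paren α)} {x : ℕ} {a : α} (h : P[x]? = some ⟨false, a⟩) :
    height P (x + 1) = height P x - 1 := by
  simp only [height, openCount_succ h, Bool.toNat_false]; push_cast; ring

theorem height_append_left {A B : List (Paren α)} {x : ℕ} (h : x ≤ A.length) :
    height (A ++ B) x = height A x := by
  simp [height, openCount, List.take_append_of_le_length h]

theorem height_append_right (A B : List (Paren α)) (x : ℕ) :
    height (A ++ B) (A.length + x) = height A A.length + height B x := by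
  simp only [height, openCount, List.take_length_add_append, List.countP_append, List.take_length]
  push_cast; ring

theorem IsForest.height_props {S : List (Paren α)} (h : IsForest S) :
    height S S.length = 0 ∧ ∀ x ≤ S.length, 0 ≤ height S x := by
  induction h with
  | nil => simp [height, openCount]
  | @append F G _ _ ihF ihG =>
    refine ⟨?_, fun x hx => ?_⟩
    · rw [List.length_append, height_append_right, ihF.1, ihG.1, add_zero]
    · rcases le_total x F.length with h | h
      · rw [height_append_left h]; exact ihF.2 x h
      · obtain ⟨y, rfl⟩ := Nat.exists_eq_add_of_le h
        rw [height_append_right, ihF.1, zero_add]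
        exact ihG.2 y (by simp at hx; omega)
  | @node F a _ ih =>
    have e : (⟨true, a⟩ :: (F ++ [⟨false, a⟩]) : List (Paren α))
        = ([⟨true, a⟩] ++ F) ++ [⟨false, a⟩] := by simp
    have h1 : height ([⟨true, a⟩] : List (Paren α)) 1 = 1 := by simp [height, openCount]
    have h2 : ∀ x, height (([⟨true, a⟩] : List (Paren α)) ++ F) (x + 1) = 1 + height F x := by
      intro x
      have := height_append_right ([⟨true, a⟩] : List (Paren α)) F x
      rw [List.length_singleton, h1, add_comm 1 x] at this
      exact this
    have hl : (([⟨true, a⟩] : List (Paren α)) ++ F).length = F.length + 1 := by simp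
    have h3 : height (([⟨true, a⟩] ++ F) ++ [⟨false, a⟩] : List (Paren α)) (F.length + 2) = 0 := by
      have := height_append_right (([⟨true, a⟩] : List (Paren α)) ++ F) [⟨false, a⟩] 1
      rw [hl, h2, ih.1] at this
      rw [show F.length + 2 = F.length + 1 + 1 by ring, this]
      simp [height, openCount]
    rw [e]
    refine ⟨?_, fun x hx => ?_⟩
    · rw [show (([⟨true, a⟩] ++ F) ++ [⟨false, a⟩] : List (Paren α)).length = F.length + 2 by
        simp]
      exact h3
    have hx' : x ≤ F.length + 2 := by simp at hx; omega
    rcases Nat.lt_or_ge x (F.length + 2) with h | h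
    · rw [height_append_left (by omega)]
      cases x with
      | zero => simp [height_zero]
      | succ x => rw [h2]; have := ih.2 x (by omega); omega
    · obtain rfl : x = F.length + 2 := by omega
      exact h3.ge

theorem fragment_append (A B P : List (Paren α)) (l : ℕ) {r : ℕ} (hr : r ≤ P.length) :
    fragment (A ++ P ++ B) (A.length + l) (A.length + r) = fragment P l r := by
  unfold fragment
  rw [List.append_assoc, List.take_length_add_append, List.take_append_of_le_length hr,
    List.drop_length_add_append]

theorem fragment_length {β : Type*} (T : List β) {l r : ℕ} (hr : r ≤ T.length) :
    (fragment T l r).length = r - l := by simp [fragment]; omega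

theorem fragment_getElem? {β : Type*} (T : List β) {l r x : ℕ} (hx : l + x < r) :
    (fragment T l r)[x]? = T[l + x]? := by
  simp [fragment, hx]

theorem height_fragment (T : List (Paren α)) {l r x : ℕ} (hx : l + x ≤ r) (hr : r ≤ T.length) :
    height (fragment T l r) x = height T (l + x) - height T l := by
  have e : T = T.take l ++ (fragment T l r ++ T.drop r) := by
    have h1 : T.take l = (T.take r).take l := by rw [List.take_take]; congr 1; omega
    rw [h1, fragment, ← List.append_assoc, List.take_append_drop, List.take_append_drop]
  have hl : (T.take l).length = l := by simp; omega
  have h1 := height_append_right (T.take l) (fragment T l r ++ T.drop r) x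
  rw [← e, hl, height_append_left (by rw [fragment_length T hr]; omega)] at h1
  have h2 : height T l = height (T.take l) l := by
    conv_lhs => rw [e]
    exact height_append_left hl.ge
  omega

theorem IsNode.lt_length {F : List (Paren α)} {i j : ℕ} (h : IsNode F i j) : j < F.length := by
  obtain ⟨-, -, ⟨a, ha⟩, -⟩ := h
  exact (List.getElem?_eq_some_iff.1 ha).1

/-- A node is an excursion of the height strictly above its starting level up to the first return.
This determines each end from the other, whence the uniqueness of mates. -/
theorem IsNode.height_props {F : List (Paren α)} {i j : ℕ} (h : IsNode F i j) :
    height F (j + 1) = height F i ∧ ∀ y, i < y → y ≤ j → height F i < height F y := by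
  have hj := h.lt_length
  obtain ⟨hij, ⟨a, ha⟩, ⟨b, hb⟩, hf⟩ := h
  have h1 := height_succ_open ha
  have h2 := height_succ_close hb
  have hp := hf.height_props
  rw [fragment_length F hj.le] at hp
  have key : ∀ y, i < y → y ≤ j →
      height (fragment F (i + 1) j) (y - (i + 1)) = height F y - height F (i + 1) := by
    intro y h3 h4
    rw [height_fragment F (by omega) hj.le]
    congr 2; omega
  refine ⟨?_, fun y h3 h4 => ?_⟩
  · have := key j hij le_rfl
    rw [hp.1] at this; omega
  · have := key y h3 h4
    have := hp.2 (y - (i + 1)) (by omega)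
    omega

theorem IsNode.right_unique {F : List (Paren α)} {i j j' : ℕ} (h : IsNode F i j)
    (h' : IsNode F i j') : j = j' := by
  have h1 := h.height_props
  have h2 := h'.height_props
  have h3 := h.1
  have h4 := h'.1
  rcases lt_trichotomy j j' with hl | hl | hl
  · have := h2.2 (j + 1) (by omega) (by omega); omega
  · exact hl
  · have := h1.2 (j' + 1) (by omega) (by omega); omega

theorem IsNode.left_unique {F : List (Paren α)} {i i' j : ℕ} (h : IsNode F i j)
    (h' : IsNode F i' j) : i = i' := by
  have h1 := h.height_props
  have h2 := h'.height_props
  have h3 := h.1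
  have h4 := h'.1
  rcases lt_trichotomy i i' with hl | hl | hl
  · have := h1.2 i' (by omega) (by omega); omega
  · exact hl
  · have := h2.2 i (by omega) (by omega); omega

theorem IsNode.not_open_close {F : List (Paren α)} {i j l : ℕ} (h : IsNode F i j)
    (h' : IsNode F l i) : False := by
  obtain ⟨-, ⟨a, ha⟩, -, -⟩ := h
  obtain ⟨-, -, ⟨b, hb⟩, -⟩ := h'
  rw [ha] at hb; simp at hb

theorem IsMate.symm {F : List (Paren α)} {i j : ℕ} (h : IsMate F i j) : IsMate F j i := Or.symm h

theorem IsMate.unique {F : List (Paren α)} {i j j' : ℕ} (h : IsMate F i j) (h' : IsMate F i j') :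
    j = j' := by
  rcases h with h | h <;> rcases h' with h' | h'
  · exact h.right_unique h'
  · exact (h.not_open_close h').elim
  · exact (h'.not_open_close h).elim
  · exact h.left_unique h'

theorem IsMate.lt_length {F : List (Paren α)} {i j : ℕ} (h : IsMate F i j) : i < F.length := by
  rcases h with h | h
  · exact h.1.trans h.lt_length
  · exact h.lt_length

theorem IsNode.append {P : List (Paren α)} {i j : ℕ} (h : IsNode P i j) (A B : List (Paren α)) :
    IsNode (A ++ P ++ B) (A.length + i) (A.length + j) := by
  have hj := h.lt_length
  obtain ⟨hij, ⟨a, ha⟩, ⟨b, hb⟩, hf⟩ := h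
  have key : ∀ x < P.length, (A ++ P ++ B)[A.length + x]? = P[x]? := by
    intro x hx
    rw [List.append_assoc, List.getElem?_append_right (by omega), Nat.add_sub_cancel_left,
      List.getElem?_append_left hx]
  refine ⟨by omega, ⟨a, by rw [key _ (by omega), ha]⟩, ⟨b, by rw [key _ hj, hb]⟩, ?_⟩
  rw [add_assoc, fragment_append _ _ _ _ hj.le]
  exact hf

theorem IsMate.append {P : List (Paren α)} {i j : ℕ} (h : IsMate P i j) (A B : List (Paren α)) :
    IsMate (A ++ P ++ B) (A.length + i) (A.length + j) :=
  h.imp (fun h => h.append A B) (fun h => h.append A B)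

theorem IsForest.exists_isMate {P : List (Paren α)} (h : IsForest P) :
    ∀ x < P.length, ∃ m, IsMate P x m := by
  induction h with
  | nil => simp
  | @append F G _ _ ihF ihG =>
    intro x hx
    rcases Nat.lt_or_ge x F.length with h | h
    · obtain ⟨m, hm⟩ := ihF x h
      exact ⟨m, by simpa using hm.append [] G⟩
    · obtain ⟨m, hm⟩ := ihG (x - F.length) (by simp at hx; omega)
      refine ⟨F.length + m, ?_⟩
      have := hm.append F []
      rwa [List.append_nil, Nat.add_sub_cancel' h] at this
  | @node F a hF ih =>
    intro x hx
    have e : (⟨true, a⟩ :: (F ++ [⟨false, a⟩]) : List (Paren α))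
        = ([⟨true, a⟩] ++ F) ++ [⟨false, a⟩] := by simp
    have hroot : IsNode (⟨true, a⟩ :: (F ++ [⟨false, a⟩])) 0 (F.length + 1) := by
      refine ⟨by omega, ⟨a, by simp⟩, ⟨a, by simp⟩, ?_⟩
      have := fragment_append [⟨true, a⟩] [⟨false, a⟩] F 0 le_rfl
      rw [e, show F.length + 1 = ([⟨true, a⟩] : List (Paren α)).length + F.length by simp; ring]
      simp only [List.length_singleton, add_zero, zero_add] at this ⊢
      rw [this]
      simpa [fragment] using hF
    simp at hx
    rcases Nat.eq_zero_or_pos x with rfl | h0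
    · exact ⟨_, Or.inl hroot⟩
    rcases Nat.lt_or_ge x (F.length + 1) with h | h
    · obtain ⟨m, hm⟩ := ih (x - 1) (by omega)
      refine ⟨1 + m, ?_⟩
      have := hm.append [⟨true, a⟩] [⟨false, a⟩]
      rw [List.length_singleton, Nat.add_sub_cancel' h0] at this
      rwa [e]
    · obtain rfl : x = F.length + 1 := by omega
      exact ⟨0, Or.inr hroot⟩

theorem IsForest.insert {T P : List (Paren α)} (hT : IsForest T) (hP : IsForest P) :
    ∀ A B, T = A ++ B → IsForest (A ++ P ++ B) := by
  induction hT with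
  | nil =>
    intro A B h
    obtain ⟨rfl, rfl⟩ := List.append_eq_nil_iff.1 h.symm
    simpa using hP
  | @append F G hF hG ihF ihG =>
    intro A B h
    rcases List.append_eq_append_iff.1 h with ⟨t, rfl, rfl⟩ | ⟨t, rfl, rfl⟩
    · simpa [List.append_assoc] using hF.append (ihG t B rfl)
    · simpa [List.append_assoc] using (ihF A t rfl).append hG
  | @node F a hF ih =>
    intro A B h
    rcases A with - | ⟨c, A⟩
    · subst h; simpa using hP.append (hF.node a)
    · simp only [List.cons_append, List.cons.injEq] at h
      obtain ⟨rfl, h⟩ := h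
      rcases List.append_eq_append_iff.1 h with ⟨t, rfl, ht⟩ | ⟨t, rfl, rfl⟩
      · rcases t with - | ⟨c, t⟩
        · simp at ht; subst ht
          simpa [List.append_assoc] using (ih F [] (by simp)).node a
        · simp at ht
          obtain ⟨rfl, rfl, rfl⟩ := ht
          simpa [List.append_assoc] using (hF.node a).append hP
      · simpa [List.append_assoc] using (ih A t rfl).node a

/-! ### Removing and exchanging balanced factors, by a stack of labels -/

/-- `S` closes exactly the open parentheses with labels `st`, the innermost one first. -/
inductive Closes : List α → List (Paren α) → Prop
  | nil : Closes [] []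
  | opening {st : List α} {S : List (Paren α)} (a : α) (h : Closes (a :: st) S) :
      Closes st (⟨true, a⟩ :: S)
  | closing {st : List α} {S : List (Paren α)} (a : α) (h : Closes st S) :
      Closes (a :: st) (⟨false, a⟩ :: S)

theorem closes_opening_iff {st : List α} {S : List (Paren α)} {a : α} :
    Closes st (⟨true, a⟩ :: S) ↔ Closes (a :: st) S :=
  ⟨fun h => by cases h; assumption, .opening a⟩

theorem closes_closing_iff {st : List α} {S : List (Paren α)} {a : α} :
    Closes (a :: st) (⟨false, a⟩ :: S) ↔ Closes st S :=
  ⟨fun h => by cases h; assumption, .closing a⟩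

/-- A balanced factor leaves the stack as it found it, so it can be dropped. Heights would not do
here, because the labels of paired parentheses must agree. -/
theorem IsForest.closes_append_iff {P : List (Paren α)} (hP : IsForest P) :
    ∀ (st : List α) (B : List (Paren α)), Closes st (P ++ B) ↔ Closes st B := by
  induction hP with
  | nil => simp
  | append _ _ ihF ihG => intro st B; rw [List.append_assoc, ihF, ihG]
  | node a _ ih =>
    intro st B
    rw [List.cons_append, closes_opening_iff, List.append_assoc, ih, List.singleton_append,
      closes_closing_iff]

theorem Closes.append_congr {X X' : List (Paren α)} (h : ∀ st, Closes st X → Closes st X') :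
    ∀ (A : List (Paren α)) (st : List α), Closes st (A ++ X) → Closes st (A ++ X') := by
  intro A
  induction A with
  | nil => exact h
  | cons c A ih =>
    intro st hc
    rw [List.cons_append] at hc ⊢
    cases hc with
    | opening a h => exact .opening a (ih _ h)
    | closing a h => exact .closing a (ih _ h)

/-- A closing step inserts an adjacent pair at the border between the stack and the remaining
string, which keeps the whole balanced. -/
theorem Closes.isForest {st : List α} {S : List (Paren α)} (h : Closes st S) :
    IsForest (st.reverse.map (fun a => (⟨true, a⟩ : Paren α)) ++ S) := by
  induction h with
  | nil => exact .nil
  | opening a h ih => simpa using ih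
  | closing a h ih =>
    have := ih.insert (P := [⟨true, a⟩, ⟨false, a⟩]) (by simpa using IsForest.nil.node a) _ _ rfl
    simpa using this

theorem closes_nil_iff {S : List (Paren α)} : Closes [] S ↔ IsForest S := by
  refine ⟨fun h => by simpa using h.isForest, fun h => ?_⟩
  have := (h.closes_append_iff [] []).2 .nil
  simpa using this

theorem IsForest.remove {A P B : List (Paren α)} (hP : IsForest P) (h : IsForest (A ++ P ++ B)) :
    IsForest (A ++ B) := by
  rw [← closes_nil_iff, List.append_assoc] at h
  exact closes_nil_iff.1 (Closes.append_congr (fun st => (hP.closes_append_iff st B).1) A [] h)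

theorem IsForest.replace {A P P' B : List (Paren α)} (hP : IsForest P) (hP' : IsForest P')
    (h : IsForest (A ++ P ++ B)) : IsForest (A ++ P' ++ B) :=
  (hP.remove h).insert hP' _ _ rfl

/-- Positions `u` and `v` correspond to each other outside the factors of lengths `p` and `q` that
start at position `a`. -/
def Outside (a p q u v : ℕ) : Prop := (u < a ∧ v = u) ∨ ∃ m, u = a + p + m ∧ v = a + q + m

/-- If both ends lie on the same side of the factor, the string between them is untouched. Otherwise
it contains the whole factor, and exchanging this factor keeps it balanced. -/
theorem IsNode.replace {A P P' B : List (Paren α)} (hP : IsForest P) (hP' : IsForest P')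
    {u u' v v' : ℕ} (h : IsNode (A ++ P ++ B) u u')
    (hu : Outside A.length P.length P'.length u v)
    (hu' : Outside A.length P.length P'.length u' v') : IsNode (A ++ P' ++ B) v v' := by
  have hlt := h.lt_length
  obtain ⟨huu, ⟨a, ha⟩, ⟨b, hb⟩, hf⟩ := h
  have key : ∀ {x y}, Outside A.length P.length P'.length x y →
      (A ++ P' ++ B)[y]? = (A ++ P ++ B)[x]? := by
    rintro x y (⟨h1, rfl⟩ | ⟨m, rfl, rfl⟩)
    · simp [List.append_assoc, List.getElem?_append_left h1]
    · rw [List.getElem?_append_right (by simp), List.getElem?_append_right (by simp)]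
      simp
  refine ⟨?_, ⟨a, by rw [key hu, ha]⟩, ⟨b, by rw [key hu', hb]⟩, ?_⟩
  · rcases hu with ⟨h1, rfl⟩ | ⟨m, rfl, rfl⟩ <;>
      rcases hu' with ⟨h2, rfl⟩ | ⟨m', rfl, rfl⟩ <;> omega
  have hl : ∀ Q : List (Paren α), ∀ l r, r ≤ A.length →
      fragment (A ++ Q ++ B) l r = fragment A l r := by
    intro Q l r hr
    have := fragment_append [] (Q ++ B) A l hr
    simpa [List.append_assoc] using this
  have hr : ∀ Q : List (Paren α), ∀ l r, r ≤ B.length →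
      fragment (A ++ Q ++ B) (A.length + Q.length + l) (A.length + Q.length + r)
        = fragment B l r := by
    intro Q l r hr
    have := fragment_append (A ++ Q) [] B l hr
    simpa [List.append_assoc] using this
  have hm : ∀ Q : List (Paren α), ∀ l r, l ≤ A.length →
      fragment (A ++ Q ++ B) l (A.length + Q.length + r) = A.drop l ++ Q ++ B.take r := by
    intro Q l r hl
    have := List.take_length_add_append (l₁ := A ++ Q) (l₂ := B) r
    rw [List.length_append] at this
    rw [fragment, this, List.append_assoc, List.drop_append_of_le_length hl, List.append_assoc]
  rcases hu with ⟨h1, rfl⟩ | ⟨m, rfl, rfl⟩ <;> rcases hu' with ⟨h2, rfl⟩ | ⟨m', rfl, rfl⟩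
  · rw [hl _ _ _ h2.le] at hf ⊢
    exact hf
  · rw [hm _ _ _ (by omega)] at hf ⊢
    exact hP.replace hP' hf
  · omega
  · rw [List.length_append, List.length_append] at hlt
    rw [add_assoc _ m 1, hr _ _ _ (by omega)] at hf ⊢
    exact hf

theorem IsMate.replace {A P P' B : List (Paren α)} (hP : IsForest P) (hP' : IsForest P')
    {u u' v v' : ℕ} (h : IsMate (A ++ P ++ B) u u')
    (hu : Outside A.length P.length P'.length u v)
    (hu' : Outside A.length P.length P'.length u' v') : IsMate (A ++ P' ++ B) v v' :=
  h.imp (fun h => h.replace hP hP' hu hu') (fun h => h.replace hP hP' hu' hu)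

/-- The mate of a character outside a balanced factor lies outside of it. -/
theorem IsMate.outside {A P B : List (Paren α)} (hP : IsForest P) {u u' : ℕ}
    (h : IsMate (A ++ P ++ B) u u') (hu : u < A.length ∨ A.length + P.length ≤ u) :
    u' < A.length ∨ A.length + P.length ≤ u' := by
  by_contra! hc
  obtain ⟨m, hm⟩ := hP.exists_isMate (u' - A.length) (by omega)
  have h1 := hm.append A B
  rw [Nat.add_sub_cancel' hc.1] at h1
  have h2 := h1.unique h.symm
  have := hm.symm.lt_length
  omega

/-! ### Periodic fragments -/

/-- The fragment `P[l .. r)` has period `p` (trivially so if it is not longer than `p`). -/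
def PeriodicOn {β : Type*} (P : List β) (l r p : ℕ) : Prop :=
  ∀ x, l ≤ x → x + p < r → P[x]? = P[x + p]?

theorem PeriodicOn.mono {β : Type*} {P : List β} {l r l' r' p : ℕ} (h : PeriodicOn P l r p)
    (hl : l ≤ l') (hr : r' ≤ r) : PeriodicOn P l' r' p :=
  fun x h1 h2 => h x (by omega) (by omega)

theorem getElem?_exists {P : List (Paren α)} {x : ℕ} (h : x < P.length) :
    ∃ a, P[x]? = some ⟨true, a⟩ ∨ P[x]? = some ⟨false, a⟩ := by
  rcases hc : P[x] with ⟨b, a⟩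
  refine ⟨a, ?_⟩
  rw [List.getElem?_eq_getElem h, hc]
  cases b <;> simp

theorem height_succ_congr {P : List (Paren α)} {x y : ℕ} (hx : x < P.length)
    (h : P[x]? = P[y]?) : height P (x + 1) - height P x = height P (y + 1) - height P y := by
  obtain ⟨a, ha | ha⟩ := getElem?_exists hx
  · rw [height_succ_open ha, height_succ_open (h ▸ ha)]; ring
  · rw [height_succ_close ha, height_succ_close (h ▸ ha)]; ring

theorem PeriodicOn.height_eq {P : List (Paren α)} {l r p : ℕ} (h : PeriodicOn P l r p)
    (hr : r ≤ P.length) : ∀ x, l ≤ x → x + p ≤ r →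
      height P (x + p) - height P x = height P (l + p) - height P l := by
  intro x hx
  induction x, hx using Nat.le_induction with
  | base => simp
  | succ x hx ih =>
    intro h2
    have h3 := ih (by omega)
    have h4 := height_succ_congr (by omega) (h x hx (by omega))
    rw [show x + 1 + p = x + p + 1 by ring]
    omega

/-- Unbalanced periods: there are characters at distance `p` whose mates come in the reverse
order. -/
theorem exists_crossing_mates {P : List (Paren α)} (hP : IsForest P) {l r p : ℕ} (hp : 0 < p)
    (h : PeriodicOn P l r p) (hr : r ≤ P.length) (h2 : l + 2 * p ≤ r)
    (hne : height P (l + p) ≠ height P l) :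
    ∃ x m m', l ≤ x ∧ x + p < r ∧ IsMate P x m ∧ IsMate P (x + p) m' ∧ m' < m := by
  have heq := h.height_eq hr
  rcases lt_or_gt_of_ne hne with hlt | hgt
  -- Falling height: take the first minimum in the second period. It lies below everything before it
  -- in the fragment, so the character before it closes, and so does the one a period earlier. The
  -- later of the two descends further, hence its mate lies further left.
  · obtain ⟨z, hz, hmin⟩ : ∃ z, (l + p < z ∧ z ≤ l + 2 * p) ∧
        (∀ y, l + p < y → y ≤ l + 2 * p → height P z ≤ height P y) ∧
        ∀ y, l + p < y → y < z → height P z < height P y := by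
      obtain ⟨z0, hz0, hmin0⟩ := Finset.exists_min_image (Finset.Ioc (l + p) (l + 2 * p))
        (height P) ⟨l + 2 * p, by simp; omega⟩
      simp only [Finset.mem_Ioc] at hz0 hmin0
      classical
      have hex : ∃ z, (l + p < z ∧ z ≤ l + 2 * p) ∧ height P z = height P z0 := ⟨z0, hz0, rfl⟩
      have hs := Nat.find_spec hex
      refine ⟨Nat.find hex, hs.1, fun y h3 h4 => hs.2.le.trans (hmin0 y ⟨h3, h4⟩),
        fun y h3 h4 => ?_⟩
      have h5 := Nat.find_min hex h4
      have h6 := hmin0 y ⟨h3, by omega⟩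
      rw [hs.2]
      refine lt_of_le_of_ne h6 fun h7 => h5 ⟨⟨h3, by omega⟩, h7.symm⟩
    obtain ⟨hmin, hfirst⟩ := hmin
    have hall : ∀ y, l ≤ y → y < z → height P z < height P y := by
      intro y h3 h4
      rcases Nat.lt_or_ge (l + p) y with h5 | h5
      · exact hfirst y h5 h4
      · have h6 := heq y h3 (by omega)
        rcases Nat.lt_or_ge l y with h7 | h7
        · have := hmin (y + p) (by omega) (by omega); omega
        · obtain rfl : y = l := by omega
          have h8 := heq (y + p) (by omega) (by omega)
          have := hmin (y + p + p) (by omega) (by omega); omega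
    obtain ⟨x, rfl⟩ : ∃ x, z = x + p + 1 := ⟨z - p - 1, by omega⟩
    have hx : l ≤ x := by omega
    have hxr : x + p < r := by omega
    have hclose : ∃ a, P[x + p]? = some ⟨false, a⟩ := by
      obtain ⟨a, ha | ha⟩ := getElem?_exists (P := P) (x := x + p) (by omega)
      · have := height_succ_open ha
        have := hall (x + p) (by omega) (by omega); omega
      · exact ⟨a, ha⟩
    obtain ⟨a, ha⟩ := hclose
    have ha' : P[x]? = some ⟨false, a⟩ := (h x hx hxr).trans ha
    obtain ⟨m, hm⟩ := hP.exists_isMate x (by omega)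
    obtain ⟨m', hm'⟩ := hP.exists_isMate (x + p) (by omega)
    refine ⟨x, m, m', hx, hxr, hm, hm', ?_⟩
    have n1 : IsNode P m x := hm.resolve_left fun hn => by
      obtain ⟨-, ⟨c, hc⟩, -⟩ := hn; rw [ha'] at hc; simp at hc
    have n2 : IsNode P m' (x + p) := hm'.resolve_left fun hn => by
      obtain ⟨-, ⟨c, hc⟩, -⟩ := hn; rw [ha] at hc; simp at hc
    have q1 := n1.height_props
    have q2 := n2.height_props
    have h3 : height P (x + p + 1) < height P (x + 1) := hall _ (by omega) (by omega)
    have h4 : m' < x := by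
      by_contra! hc
      have := hall m' (by omega) (by have := n2.1; omega); omega
    by_contra! hc
    rcases Nat.lt_or_ge m m' with h5 | h5
    · have := q1.2 m' h5 (by omega); omega
    · obtain rfl : m = m' := by omega
      omega
  -- Rising height: take the last minimum in the first period. The height stays above it for more
  -- than a period, so the node opened there contains the one opened a period later.
  · obtain ⟨z, hz, hmin, hlast⟩ : ∃ z, (l ≤ z ∧ z < l + p) ∧
        (∀ y, l ≤ y → y < l + p → height P z ≤ height P y) ∧
        ∀ y, z < y → y < l + p → height P z < height P y := by
      obtain ⟨z0, hz0, hmin0⟩ := Finset.exists_min_image (Finset.Ico l (l + p))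
        (height P) ⟨l, by simp; omega⟩
      simp only [Finset.mem_Ico] at hz0 hmin0
      classical
      have hs := Nat.findGreatest_spec
        (P := fun z => l ≤ z ∧ z < l + p ∧ height P z = height P z0)
        (n := l + p) (by omega : z0 ≤ l + p) ⟨hz0.1, hz0.2, rfl⟩
      refine ⟨_, ⟨hs.1, hs.2.1⟩, fun y h3 h4 => hs.2.2.le.trans (hmin0 y ⟨h3, h4⟩),
        fun y h3 h4 => ?_⟩
      have h5 := Nat.findGreatest_is_greatest h3 (by omega)
      have h6 := hmin0 y ⟨by omega, h4⟩
      rw [hs.2.2]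
      exact lt_of_le_of_ne h6 fun h7 => h5 ⟨by omega, h4, h7.symm⟩
    have hall : ∀ y, z < y → y ≤ z + p + 1 → height P z < height P y := by
      intro y h3 h4
      rcases Nat.lt_or_ge y (l + p) with h5 | h5
      · exact hlast y h3 h5
      · obtain ⟨t, rfl⟩ : ∃ t, y = t + p := ⟨y - p, by omega⟩
        have h6 := heq t (by omega) (by omega)
        rcases Nat.lt_or_ge t (l + p) with h7 | h7
        · have := hmin t (by omega) h7; omega
        · obtain ⟨s, rfl⟩ : ∃ s, t = s + p := ⟨t - p, by omega⟩
          have h8 := heq s (by omega) (by omega)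
          have := hmin s (by omega) (by omega); omega
    obtain ⟨a, ha⟩ : ∃ a, P[z]? = some ⟨true, a⟩ := by
      obtain ⟨a, ha | ha⟩ := getElem?_exists (P := P) (x := z) (by omega)
      · exact ⟨a, ha⟩
      · have := height_succ_close ha
        have := hall (z + 1) (by omega) (by omega); omega
    have ha' : P[z + p]? = some ⟨true, a⟩ := (h z (by omega) (by omega)).symm.trans ha
    obtain ⟨m, hm⟩ := hP.exists_isMate z (by omega)
    obtain ⟨m', hm'⟩ := hP.exists_isMate (z + p) (by omega)
    refine ⟨z, m, m', hz.1, by omega, hm, hm', ?_⟩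
    have n1 : IsNode P z m := hm.resolve_right fun hn => by
      obtain ⟨-, -, ⟨c, hc⟩, -⟩ := hn; rw [ha] at hc; simp at hc
    have n2 : IsNode P (z + p) m' := hm'.resolve_right fun hn => by
      obtain ⟨-, -, ⟨c, hc⟩, -⟩ := hn; rw [ha'] at hc; simp at hc
    have q1 := n1.height_props
    have q2 := n2.height_props
    have h3 : z + p < m := by
      by_contra! hc
      have := hall (m + 1) (by have := n1.1; omega) (by omega); omega
    have h5 := hall (z + p) (by omega) (by omega)
    by_contra! hc
    rcases Nat.lt_or_ge m m' with h6 | h6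
    · have := q2.2 (m + 1) (by omega) (by omega); omega
    · obtain rfl : m = m' := by omega
      omega

end

/-! ### Walks in the alignment graph -/

/-- `Walk w X Y x y x' y' M c`: there is a path from `(x, y)` to `(x', y')` in the alignment graph
of `X` and `Y` that aligns exactly the pairs in `M` and has cost `c`. -/
inductive Walk {α : Type*} (w : Option α → Option α → ℝ≥0) (X Y : List (Paren α)) :
    ℕ → ℕ → ℕ → ℕ → List (ℕ × ℕ) → ℝ≥0 → Prop
  | nil (x y : ℕ) : Walk w X Y x y x y [] 0
  | del {x y x' y' : ℕ} {M : List (ℕ × ℕ)} {c : ℝ≥0} {a : Paren α} (ha : X[x]? = some a)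
      (h : Walk w X Y (x + 1) y x' y' M c) :
      Walk w X Y x y x' y' M (halfWeight w (some a) none + c)
  | ins {x y x' y' : ℕ} {M : List (ℕ × ℕ)} {c : ℝ≥0} {b : Paren α} (hb : Y[y]? = some b)
      (h : Walk w X Y x (y + 1) x' y' M c) :
      Walk w X Y x y x' y' M (halfWeight w none (some b) + c)
  | diag {x y x' y' : ℕ} {M : List (ℕ × ℕ)} {c : ℝ≥0} {a b : Paren α} (ha : X[x]? = some a)
      (hb : Y[y]? = some b) (h : Walk w X Y (x + 1) (y + 1) x' y' M c) :
      Walk w X Y x y x' y' ((x, y) :: M) (halfWeight w (some a) (some b) + c)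

section
variable {α : Type*} {w : Option α → Option α → ℝ≥0} {X Y : List (Paren α)}
  {x y x' y' x'' y'' : ℕ} {M M' : List (ℕ × ℕ)} {c c' : ℝ≥0}

theorem Walk.le (h : Walk w X Y x y x' y' M c) : x ≤ x' ∧ y ≤ y' := by
  induction h <;> omega

theorem Walk.append (h : Walk w X Y x y x' y' M c) (h' : Walk w X Y x' y' x'' y'' M' c') :
    Walk w X Y x y x'' y'' (M ++ M') (c + c') := by
  induction h with
  | nil => simpa using h'
  | del ha _ ih => rw [add_assoc]; exact .del ha (ih h')
  | ins hb _ ih => rw [add_assoc]; exact .ins hb (ih h')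
  | diag ha hb _ ih => rw [add_assoc]; exact .diag ha hb (ih h')

theorem Walk.mem_bounds (h : Walk w X Y x y x' y' M c) :
    ∀ u v, (u, v) ∈ M → (x ≤ u ∧ u < x') ∧ (y ≤ v ∧ v < y') := by
  induction h with
  | nil => simp
  | del _ h ih => intro u v hm; have := ih u v hm; omega
  | ins _ h ih => intro u v hm; have := ih u v hm; omega
  | diag _ _ h ih =>
    intro u v hm
    have hl := h.le
    rcases List.mem_cons.1 hm with he | hm
    · simp only [Prod.mk.injEq] at he; omega
    · have := ih u v hm; omega

theorem Walk.pairwise (h : Walk w X Y x y x' y' M c) :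
    M.Pairwise (fun p q => p.1 < q.1 ∧ p.2 < q.2) := by
  induction h with
  | nil => simp
  | del _ _ ih => exact ih
  | ins _ _ ih => exact ih
  | diag _ _ h ih =>
    refine List.pairwise_cons.2 ⟨fun q hq => ?_, ih⟩
    have := h.mem_bounds q.1 q.2 hq
    omega

theorem Walk.lt_iff (h : Walk w X Y x y x' y' M c) {u v u' v' : ℕ} (h1 : (u, v) ∈ M)
    (h2 : (u', v') ∈ M) : u < u' ↔ v < v' := by
  by_cases he : (u, v) = (u', v')
  · simp only [Prod.mk.injEq] at he; omega
  · have : Std.Symm fun p q : ℕ × ℕ => (p.1 < q.1 ∧ p.2 < q.2) ∨ (q.1 < p.1 ∧ q.2 < p.2) :=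
      ⟨fun _ _ h => Or.symm h⟩
    have h3 := (h.pairwise.imp (S := fun p q => (p.1 < q.1 ∧ p.2 < q.2) ∨ (q.1 < p.1 ∧ q.2 < p.2))
      (fun h => Or.inl h)).forall h1 h2 he
    simp only at h3
    omega

theorem Walk.mem_split (h : Walk w X Y x y x' y' M c) : ∀ u v, (u, v) ∈ M →
    ∃ M₁ M₂ c₁ c₂ a b, X[u]? = some a ∧ Y[v]? = some b ∧ Walk w X Y x y u v M₁ c₁ ∧
      Walk w X Y u v x' y' M₂ c₂ ∧ M = M₁ ++ M₂ ∧ c = c₁ + c₂ ∧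
      halfWeight w (some a) (some b) ≤ c₂ := by
  induction h with
  | nil => simp
  | del ha _ ih =>
    intro u v hm
    obtain ⟨M₁, M₂, c₁, c₂, a, b, h1, h2, h3, h4, rfl, rfl, h5⟩ := ih u v hm
    exact ⟨M₁, M₂, _, c₂, a, b, h1, h2, .del ha h3, h4, rfl, (add_assoc _ _ _).symm, h5⟩
  | ins ha _ ih =>
    intro u v hm
    obtain ⟨M₁, M₂, c₁, c₂, a, b, h1, h2, h3, h4, rfl, rfl, h5⟩ := ih u v hm
    exact ⟨M₁, M₂, _, c₂, a, b, h1, h2, .ins ha h3, h4, rfl, (add_assoc _ _ _).symm, h5⟩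
  | @diag x y x' y' M c a b ha hb h ih =>
    intro u v hm
    rcases List.mem_cons.1 hm with he | hm
    · simp only [Prod.mk.injEq] at he
      obtain ⟨rfl, rfl⟩ := he
      exact ⟨[], _, 0, _, a, b, ha, hb, .nil _ _, .diag ha hb h, rfl, (zero_add _).symm,
        le_self_add⟩
    · obtain ⟨M₁, M₂, c₁, c₂, a', b', h1, h2, h3, h4, rfl, rfl, h5⟩ := ih u v hm
      exact ⟨_, M₂, _, c₂, a', b', h1, h2, .diag ha hb h3, h4, rfl, (add_assoc _ _ _).symm, h5⟩

/-- A walk across the corner `(f, g)` passes through a point with `x = f` or `y = g` where it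
leaves the region to the lower left of the corner. -/
theorem Walk.split_leave (h : Walk w X Y x y x' y' M c) {f g : ℕ} (hx : x ≤ f) (hy : y ≤ g)
    (hx' : f ≤ x') (hy' : g ≤ y') :
    ∃ u v M₁ M₂ c₁ c₂, Walk w X Y x y u v M₁ c₁ ∧ Walk w X Y u v x' y' M₂ c₂ ∧ M = M₁ ++ M₂ ∧
      c = c₁ + c₂ ∧ u ≤ f ∧ v ≤ g ∧ (u = f ∨ v = g) := by
  induction h with
  | nil x y => exact ⟨x, y, [], [], 0, 0, .nil _ _, .nil _ _, rfl, by simp, hx, hy, by omega⟩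
  | @del x y x' y' M c a ha h ih =>
    rcases hx.eq_or_lt with rfl | hlt
    · exact ⟨x, y, [], _, 0, _, .nil _ _, .del ha h, rfl, by simp, le_rfl, hy, Or.inl rfl⟩
    · obtain ⟨u, v, M₁, M₂, c₁, c₂, h3, h4, rfl, rfl, h5⟩ := ih hlt hy hx' hy'
      exact ⟨u, v, M₁, M₂, _, c₂, .del ha h3, h4, rfl, (add_assoc _ _ _).symm, h5⟩
  | @ins x y x' y' M c a ha h ih =>
    rcases hy.eq_or_lt with rfl | hlt
    · exact ⟨x, y, [], _, 0, _, .nil _ _, .ins ha h, rfl, by simp, hx, le_rfl, Or.inr rfl⟩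
    · obtain ⟨u, v, M₁, M₂, c₁, c₂, h3, h4, rfl, rfl, h5⟩ := ih hx hlt hx' hy'
      exact ⟨u, v, M₁, M₂, _, c₂, .ins ha h3, h4, rfl, (add_assoc _ _ _).symm, h5⟩
  | @diag x y x' y' M c a b ha hb h ih =>
    rcases hx.eq_or_lt with rfl | hlt
    · exact ⟨x, y, [], _, 0, _, .nil _ _, .diag ha hb h, rfl, by simp, le_rfl, hy, Or.inl rfl⟩
    · rcases hy.eq_or_lt with rfl | hlt'
      · exact ⟨x, y, [], _, 0, _, .nil _ _, .diag ha hb h, rfl, by simp, hx, le_rfl, Or.inr rfl⟩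
      · obtain ⟨u, v, M₁, M₂, c₁, c₂, h3, h4, rfl, rfl, h5⟩ := ih hlt hlt' hx' hy'
        exact ⟨u, v, _, M₂, _, c₂, .diag ha hb h3, h4, rfl, (add_assoc _ _ _).symm, h5⟩

/-- A walk across the corner `(f, g)` passes through a point with `x = f` or `y = g` where it
enters the region to the upper right of the corner. -/
theorem Walk.split_enter (h : Walk w X Y x y x' y' M c) {f g : ℕ} (hxy : x ≤ f ∨ y ≤ g)
    (hx' : f ≤ x') (hy' : g ≤ y') :
    ∃ u v M₁ M₂ c₁ c₂, Walk w X Y x y u v M₁ c₁ ∧ Walk w X Y u v x' y' M₂ c₂ ∧ M = M₁ ++ M₂ ∧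
      c = c₁ + c₂ ∧ f ≤ u ∧ g ≤ v ∧ (u = f ∨ v = g) := by
  by_cases hfg : f ≤ x ∧ g ≤ y
  · exact ⟨x, y, [], M, 0, c, .nil _ _, h, rfl, by simp, hfg.1, hfg.2, by omega⟩
  induction h with
  | nil x y => omega
  | @del x y x' y' M c a ha h ih =>
    by_cases h1 : f ≤ x + 1 ∧ g ≤ y
    · exact ⟨x + 1, y, [], M, _, c, .del ha (.nil _ _), h, rfl, by simp, h1.1, h1.2, by omega⟩
    obtain ⟨u, v, M₁, M₂, c₁, c₂, h3, h4, rfl, rfl, h5⟩ := ih (by omega) hx' hy' h1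
    exact ⟨u, v, M₁, M₂, _, c₂, .del ha h3, h4, rfl, (add_assoc _ _ _).symm, h5⟩
  | @ins x y x' y' M c a ha h ih =>
    by_cases h1 : f ≤ x ∧ g ≤ y + 1
    · exact ⟨x, y + 1, [], M, _, c, .ins ha (.nil _ _), h, rfl, by simp, h1.1, h1.2, by omega⟩
    obtain ⟨u, v, M₁, M₂, c₁, c₂, h3, h4, rfl, rfl, h5⟩ := ih (by omega) hx' hy' h1
    exact ⟨u, v, M₁, M₂, _, c₂, .ins ha h3, h4, rfl, (add_assoc _ _ _).symm, h5⟩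
  | @diag x y x' y' M c a b ha hb h ih =>
    by_cases h1 : f ≤ x + 1 ∧ g ≤ y + 1
    · exact ⟨x + 1, y + 1, [_], M, _, c, .diag ha hb (.nil _ _), h, rfl, by simp, h1.1, h1.2,
        by omega⟩
    obtain ⟨u, v, M₁, M₂, c₁, c₂, h3, h4, rfl, rfl, h5⟩ := ih (by omega) hx' hy' h1
    exact ⟨u, v, _, M₂, _, c₂, .diag ha hb h3, h4, rfl, (add_assoc _ _ _).symm, h5⟩

theorem Walk.split_x (h : Walk w X Y x y x' y' M c) {f : ℕ} (hx : x ≤ f) (hx' : f ≤ x') :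
    ∃ v M₁ M₂ c₁ c₂, Walk w X Y x y f v M₁ c₁ ∧ Walk w X Y f v x' y' M₂ c₂ ∧ M = M₁ ++ M₂ ∧
      c = c₁ + c₂ := by
  rcases hx.eq_or_lt with rfl | hlt
  · exact ⟨y, [], M, 0, c, .nil _ _, h, rfl, by simp⟩
  induction h with
  | nil x y => omega
  | @del x y x' y' M c a ha h ih =>
    rcases hx.eq_or_lt with rfl | hlt'
    · omega
    rcases Nat.eq_or_lt_of_le hlt with rfl | hlt'
    · exact ⟨y, [], M, _, c, .del ha (.nil _ _), h, rfl, by simp⟩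
    obtain ⟨v, M₁, M₂, c₁, c₂, h3, h4, rfl, rfl⟩ := ih hlt hx' hlt'
    exact ⟨v, M₁, M₂, _, c₂, .del ha h3, h4, rfl, (add_assoc _ _ _).symm⟩
  | @ins x y x' y' M c a ha h ih =>
    obtain ⟨v, M₁, M₂, c₁, c₂, h3, h4, rfl, rfl⟩ := ih hx hx' hlt
    exact ⟨v, M₁, M₂, _, c₂, .ins ha h3, h4, rfl, (add_assoc _ _ _).symm⟩
  | @diag x y x' y' M c a b ha hb h ih =>
    rcases Nat.eq_or_lt_of_le hlt with rfl | hlt'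
    · exact ⟨y + 1, [_], M, _, c, .diag ha hb (.nil _ _), h, rfl, by simp⟩
    obtain ⟨v, M₁, M₂, c₁, c₂, h3, h4, rfl, rfl⟩ := ih hlt hx' hlt'
    exact ⟨v, _, M₂, _, c₂, .diag ha hb h3, h4, rfl, (add_assoc _ _ _).symm⟩

/-! ### Costs of walks -/

/-- The cost of inserting `Y[l .. r)`. -/
noncomputable def insCost (w : Option α → Option α → ℝ≥0) (Y : List (Paren α)) (l r : ℕ) : ℝ≥0 :=
  ∑ v ∈ Finset.Ico l r, halfWeight w none Y[v]?

/-- The cost of deleting `X[l .. r)`. -/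
noncomputable def delCost (w : Option α → Option α → ℝ≥0) (X : List (Paren α)) (l r : ℕ) : ℝ≥0 :=
  ∑ u ∈ Finset.Ico l r, halfWeight w X[u]? none

theorem halfWeight_triangle (hw : IsQuasimetric w) (p q r : Option (Paren α)) :
    halfWeight w p r ≤ halfWeight w p q + halfWeight w q r := by
  unfold halfWeight
  rw [← add_div]
  gcongr
  exact hw _ _ _

/-- The triangle inequality, summed over the edges: creating the `Y`-part directly is no dearer than
creating the `X`-part and editing it along the walk. -/
theorem Walk.insCost_le (hw : IsQuasimetric w) (h : Walk w X Y x y x' y' M c) :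
    insCost w Y y y' ≤ insCost w X x x' + c := by
  unfold insCost
  induction h with
  | nil => simp
  | @del x y x' y' M c a ha h ih =>
    rw [Finset.sum_eq_sum_Ico_succ_bot (Nat.lt_of_succ_le h.le.1)]
    calc _ ≤ _ := ih
      _ ≤ _ := add_le_add le_add_self le_add_self
  | @ins x y x' y' M c b hb h ih =>
    rw [Finset.sum_eq_sum_Ico_succ_bot (Nat.lt_of_succ_le h.le.2), hb]
    calc _ ≤ _ := add_le_add_right ih _
      _ = _ := by ring
  | @diag x y x' y' M c a b ha hb h ih =>
    rw [Finset.sum_eq_sum_Ico_succ_bot (Nat.lt_of_succ_le h.le.2), hb,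
      Finset.sum_eq_sum_Ico_succ_bot (Nat.lt_of_succ_le h.le.1), ha]
    calc _ ≤ _ := add_le_add (halfWeight_triangle hw none (some a) (some b)) ih
      _ = _ := by ring

theorem Walk.delCost_le (hw : IsQuasimetric w) (h : Walk w X Y x y x' y' M c) :
    delCost w X x x' ≤ delCost w Y y y' + c := by
  unfold delCost
  induction h with
  | nil => simp
  | @ins x y x' y' M c b hb h ih =>
    rw [Finset.sum_eq_sum_Ico_succ_bot (Nat.lt_of_succ_le h.le.2)]
    calc _ ≤ _ := ih
      _ ≤ _ := add_le_add le_add_self le_add_self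
  | @del x y x' y' M c a ha h ih =>
    rw [Finset.sum_eq_sum_Ico_succ_bot (Nat.lt_of_succ_le h.le.1), ha]
    calc _ ≤ _ := add_le_add_right ih _
      _ = _ := by ring
  | @diag x y x' y' M c a b ha hb h ih =>
    rw [Finset.sum_eq_sum_Ico_succ_bot (Nat.lt_of_succ_le h.le.2), hb,
      Finset.sum_eq_sum_Ico_succ_bot (Nat.lt_of_succ_le h.le.1), ha]
    calc _ ≤ _ := add_le_add (halfWeight_triangle hw (some a) (some b) none) ih
      _ = _ := by ring

theorem walk_ins (hy : y ≤ y') (hY : y' ≤ Y.length) :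
    Walk w X Y x y x y' [] (insCost w Y y y') := by
  obtain ⟨d, rfl⟩ := Nat.exists_eq_add_of_le hy
  clear hy
  induction d generalizing y with
  | zero => simpa [insCost] using Walk.nil x y
  | succ d ih =>
    rw [insCost, Finset.sum_eq_sum_Ico_succ_bot (by omega), List.getElem?_eq_getElem (by omega)]
    refine .ins (List.getElem?_eq_getElem (by omega)) ?_
    rw [show y + (d + 1) = y + 1 + d by ring] at hY ⊢
    exact ih hY

theorem walk_del (hx : x ≤ x') (hX : x' ≤ X.length) :
    Walk w X Y x y x' y [] (delCost w X x x') := by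
  obtain ⟨d, rfl⟩ := Nat.exists_eq_add_of_le hx
  clear hx
  induction d generalizing x with
  | zero => simpa [delCost] using Walk.nil x y
  | succ d ih =>
    rw [delCost, Finset.sum_eq_sum_Ico_succ_bot (by omega), List.getElem?_eq_getElem (by omega)]
    refine .del (List.getElem?_eq_getElem (by omega)) ?_
    rw [show x + (d + 1) = x + 1 + d by ring] at hX ⊢
    exact ih hX

theorem halfWeight_self (hw : Normalized w) (p : Option (Paren α)) : halfWeight w p p = 0 := by
  simp [halfWeight, hw.1]

theorem walk_diag (hw : Normalized w) (f g p : ℕ) (hX : f + p ≤ X.length)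
    (hXY : ∀ t < p, X[f + t]? = Y[g + t]?) :
    ∃ M, Walk w X Y f g (f + p) (g + p) M 0 ∧
      ∀ u v, (u, v) ∈ M ↔ ∃ t < p, u = f + t ∧ v = g + t := by
  induction p generalizing f g with
  | zero => exact ⟨[], .nil _ _, by simp⟩
  | succ p ih =>
    obtain ⟨M, hM, hm⟩ := ih (f + 1) (g + 1) (by omega) (fun t ht => by
      have := hXY (t + 1) (by omega)
      rwa [show f + 1 + t = f + (t + 1) by ring, show g + 1 + t = g + (t + 1) by ring])
    have ha : X[f]? = some X[f] := List.getElem?_eq_getElem (by omega)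
    have hb : Y[g]? = some X[f] := by rw [← ha]; simpa using (hXY 0 (by omega)).symm
    refine ⟨(f, g) :: M, ?_, fun u v => ?_⟩
    · have := Walk.diag ha hb hM
      rw [halfWeight_self hw, add_zero] at this
      rwa [show f + (p + 1) = f + 1 + p by ring, show g + (p + 1) = g + 1 + p by ring]
    · simp only [List.mem_cons, Prod.mk.injEq, hm]
      constructor
      · rintro (⟨rfl, rfl⟩ | ⟨t, ht, rfl, rfl⟩)
        · exact ⟨0, by omega, rfl, rfl⟩
        · exact ⟨t + 1, by omega, by omega, by omega⟩
      · rintro ⟨t, ht, rfl, rfl⟩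
        rcases t with - | t
        · exact Or.inl ⟨rfl, rfl⟩
        · exact Or.inr ⟨t, by omega, by omega, by omega⟩

/-- Translation of a walk. -/
theorem Walk.translate {X' Y' : List (Paren α)} {a a' b b' : ℕ}
    (h : Walk w X Y x y x' y' M c) (hx : a ≤ x) (hy : b ≤ y)
    (hX : ∀ t, a + t < x' → X'[a' + t]? = X[a + t]?)
    (hY : ∀ t, b + t < y' → Y'[b' + t]? = Y[b + t]?) :
    Walk w X' Y' (a' + (x - a)) (b' + (y - b)) (a' + (x' - a)) (b' + (y' - b))
      (M.map fun p => (a' + (p.1 - a), b' + (p.2 - b))) c := by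
  induction h with
  | nil => exact .nil _ _
  | @del x y x' y' M c a ha h ih =>
    have hl := h.le
    refine .del (by rw [hX _ (by omega), Nat.add_sub_cancel' hx, ha]) ?_
    have := ih (by omega) hy hX hY
    rwa [Nat.sub_add_comm hx] at this
  | @ins x y x' y' M c a ha h ih =>
    have hl := h.le
    refine .ins (by rw [hY _ (by omega), Nat.add_sub_cancel' hy, ha]) ?_
    have := ih hx (by omega) hX hY
    rwa [Nat.sub_add_comm hy] at this
  | @diag x y x' y' M c a b ha hb h ih =>
    have hl := h.le
    refine .diag (by rw [hX _ (by omega), Nat.add_sub_cancel' hx, ha])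
      (by rw [hY _ (by omega), Nat.add_sub_cancel' hy, hb]) ?_
    have := ih (by omega) (by omega) hX hY
    rwa [Nat.sub_add_comm hx, Nat.sub_add_comm hy] at this

theorem insCost_add (h : x ≤ y) (h' : y ≤ x') :
    insCost w X x x' = insCost w X x y + insCost w X y x' :=
  (Finset.sum_Ico_consecutive _ h h').symm

theorem delCost_add (h : x ≤ y) (h' : y ≤ x') :
    delCost w X x x' = delCost w X x y + delCost w X y x' :=
  (Finset.sum_Ico_consecutive _ h h').symm

theorem insCost_congr {f g t : ℕ} (h : ∀ s < t, X[f + s]? = Y[g + s]?) :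
    insCost w X f (f + t) = insCost w Y g (g + t) := by
  unfold insCost
  rw [Finset.sum_Ico_eq_sum_range, Finset.sum_Ico_eq_sum_range, Nat.add_sub_cancel_left,
    Nat.add_sub_cancel_left]
  exact Finset.sum_congr rfl fun s hs => by rw [h s (Finset.mem_range.1 hs)]

theorem delCost_congr {f g t : ℕ} (h : ∀ s < t, X[f + s]? = Y[g + s]?) :
    delCost w X f (f + t) = delCost w Y g (g + t) := by
  unfold delCost
  rw [Finset.sum_Ico_eq_sum_range, Finset.sum_Ico_eq_sum_range, Nat.add_sub_cancel_left,
    Nat.add_sub_cancel_left]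
  exact Finset.sum_congr rfl fun s hs => by rw [h s (Finset.mem_range.1 hs)]

/-! ### Rerouting walks around a common factor -/

/-- If a walk leads to the end of a common factor, then there is a walk that leads to the start of
this factor at no higher cost. -/
theorem Walk.reroute_left (hq : IsQuasimetric w) {f g t : ℕ}
    (h : Walk w X Y x y (f + t) (g + t) M c) (hx : x ≤ f) (hy : y ≤ g) (hf : f ≤ X.length)
    (hg : g ≤ Y.length) (hXY : ∀ s < t, X[f + s]? = Y[g + s]?) :
    ∃ M' c', Walk w X Y x y f g M' c' ∧ c' ≤ c ∧
      ∀ u v, (u, v) ∈ M' ↔ (u, v) ∈ M ∧ u < f ∧ v < g := by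
  obtain ⟨u, v, M₁, M₂, c₁, c₂, h1, h2, rfl, rfl, hu, hv, huv⟩ :=
    h.split_leave hx hy (by omega) (by omega)
  have hM : ∀ a b, (a, b) ∈ M₁ ↔ (a, b) ∈ M₁ ++ M₂ ∧ a < f ∧ b < g := by
    intro a b
    rw [List.mem_append]
    refine ⟨fun hm => ⟨Or.inl hm, ?_⟩, fun ⟨hm, h3⟩ => hm.resolve_right fun hm => ?_⟩
    · have := h1.mem_bounds a b hm; omega
    · have := h2.mem_bounds a b hm; omega
  rcases huv with rfl | rfl
  · refine ⟨_, _, h1.append (walk_ins hv hg), ?_, by simpa using hM⟩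
    gcongr
    -- The rest of the walk turns the whole common factor of `X` into `Y[v .. g + t)`. The insertion
    -- cost of the common factor appears on both sides and cancels, so `c₂` pays for inserting `Y[v
    -- .. g)`.
    have h3 := h2.insCost_le hq
    rw [insCost_add hv (by omega), insCost_congr hXY, add_comm] at h3
    exact le_of_add_le_add_left h3
  · refine ⟨_, _, h1.append (walk_del hu hf), ?_, by simpa using hM⟩
    gcongr
    have h3 := h2.delCost_le hq
    rw [delCost_add hu (by omega), delCost_congr hXY, add_comm] at h3
    exact le_of_add_le_add_left h3

/-- If a walk starts at the start of a common factor, then there is a walk that starts at the end of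
this factor and has no higher cost. -/
theorem Walk.reroute_right (hq : IsQuasimetric w) {f g t : ℕ}
    (h : Walk w X Y f g x' y' M c) (hx : f + t ≤ x') (hy : g + t ≤ y') (hx' : x' ≤ X.length)
    (hy' : y' ≤ Y.length) (hXY : ∀ s < t, X[f + s]? = Y[g + s]?) :
    ∃ M' c', Walk w X Y (f + t) (g + t) x' y' M' c' ∧ c' ≤ c ∧
      ∀ u v, (u, v) ∈ M' ↔ (u, v) ∈ M ∧ f + t ≤ u ∧ g + t ≤ v := by
  obtain ⟨u, v, M₁, M₂, c₁, c₂, h1, h2, rfl, rfl, hu, hv, huv⟩ :=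
    h.split_enter (f := f + t) (g := g + t) (Or.inl (by omega)) hx hy
  have hl := h2.le
  have hM : ∀ a b, (a, b) ∈ M₂ ↔ (a, b) ∈ M₁ ++ M₂ ∧ f + t ≤ a ∧ g + t ≤ b := by
    intro a b
    rw [List.mem_append]
    refine ⟨fun hm => ⟨Or.inr hm, ?_⟩, fun ⟨hm, h3⟩ => hm.resolve_left fun hm => ?_⟩
    · have := h2.mem_bounds a b hm; omega
    · have := h1.mem_bounds a b hm; omega
  rcases huv with rfl | rfl
  · refine ⟨_, _, (walk_ins hv (by omega)).append h2, ?_, by simpa using hM⟩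
    gcongr
    have h3 := h1.insCost_le hq
    rw [insCost_add (y := g + t) (by omega) (by omega), insCost_congr hXY] at h3
    exact le_of_add_le_add_left h3
  · refine ⟨_, _, (walk_del hu (by omega)).append h2, ?_, by simpa using hM⟩
    gcongr
    have h3 := h1.delCost_le hq
    rw [delCost_add (y := f + t) (by omega) (by omega), delCost_congr hXY] at h3
    exact le_of_add_le_add_left h3

theorem getElem?_left {A B C : List (Paren α)} {i : ℕ} (h : i < A.length) :
    (A ++ B ++ C)[i]? = A[i]? := by
  rw [List.append_assoc, List.getElem?_append_left h]

theorem getElem?_mid {A B C : List (Paren α)} {i : ℕ} (h : i < B.length) :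
    (A ++ B ++ C)[A.length + i]? = B[i]? := by
  rw [List.append_assoc, List.getElem?_append_right (by omega), Nat.add_sub_cancel_left,
    List.getElem?_append_left h]

theorem getElem?_right {A B C : List (Paren α)} {i : ℕ} :
    (A ++ B ++ C)[A.length + B.length + i]? = C[i]? := by
  rw [List.getElem?_append_right (by simp), List.length_append, Nat.add_sub_cancel_left]

/-- A walk that meets the main diagonal of a common factor `P` can be turned into a walk that uses
the main diagonal of a factor `P'` in its place. -/
theorem Walk.replace (hn : Normalized w) (hq : IsQuasimetric w) {F₁ F₂ G₁ G₂ P : List (Paren α)}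
    (P' : List (Paren α)) {t : ℕ} (ht : t ≤ P.length)
    (h1 : Walk w (F₁ ++ P ++ F₂) (G₁ ++ P ++ G₂) 0 0 (F₁.length + t) (G₁.length + t) M c)
    (h2 : Walk w (F₁ ++ P ++ F₂) (G₁ ++ P ++ G₂) (F₁.length + t) (G₁.length + t)
      (F₁ ++ P ++ F₂).length (G₁ ++ P ++ G₂).length M' c') :
    ∃ N d, Walk w (F₁ ++ P' ++ F₂) (G₁ ++ P' ++ G₂) 0 0
        (F₁ ++ P' ++ F₂).length (G₁ ++ P' ++ G₂).length N d ∧ d ≤ c + c' ∧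
      ∀ u v, (u, v) ∈ N ↔ ((u, v) ∈ M ++ M' ∧ u < F₁.length ∧ v < G₁.length) ∨
        (∃ s < P'.length, u = F₁.length + s ∧ v = G₁.length + s) ∨
        ∃ m m', u = F₁.length + P'.length + m ∧ v = G₁.length + P'.length + m' ∧
          (F₁.length + P.length + m, G₁.length + P.length + m') ∈ M ++ M' := by
  have hmid : ∀ s < P.length, (F₁ ++ P ++ F₂)[F₁.length + s]? = (G₁ ++ P ++ G₂)[G₁.length + s]? :=
    fun s hs => by rw [getElem?_mid hs, getElem?_mid hs]
  -- The new walk has three pieces: one to the lower corner of the square, the free diagonal of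
  -- `P'`, and one from the upper corner. The outer pieces are translated, as they never read `P`.
  obtain ⟨M₁, c₁, k1, l1, m1⟩ := h1.reroute_left hq (Nat.zero_le _) (Nat.zero_le _)
    (by simp) (by simp) (fun s hs => hmid s (by omega))
  obtain ⟨M₃, c₃, k3, l3, m3⟩ := h2.reroute_right (t := P.length - t) hq (by simp; omega)
    (by simp; omega) le_rfl le_rfl (fun s hs => by
      rw [add_assoc, add_assoc]; exact hmid _ (by omega))
  rw [add_assoc, add_assoc, Nat.add_sub_cancel' ht] at k3
  simp only [add_assoc, Nat.add_sub_cancel' ht] at m3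
  obtain ⟨M₂, k2, m2⟩ := walk_diag (X := F₁ ++ P' ++ F₂) (Y := G₁ ++ P' ++ G₂) hn F₁.length
    G₁.length P'.length (by simp) (fun s hs => by rw [getElem?_mid hs, getElem?_mid hs])
  have k1' := k1.translate (X' := F₁ ++ P' ++ F₂) (Y' := G₁ ++ P' ++ G₂) (a := 0) (a' := 0)
    (b := 0) (b' := 0) le_rfl le_rfl
    (fun s hs => by rw [getElem?_left (by omega), getElem?_left (by omega)])
    (fun s hs => by rw [getElem?_left (by omega), getElem?_left (by omega)])
  have k3' := k3.translate (X' := F₁ ++ P' ++ F₂) (Y' := G₁ ++ P' ++ G₂)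
    (a := F₁.length + P.length) (a' := F₁.length + P'.length)
    (b := G₁.length + P.length) (b' := G₁.length + P'.length) le_rfl le_rfl
    (fun s hs => by rw [getElem?_right, getElem?_right])
    (fun s hs => by rw [getElem?_right, getElem?_right])
  simp only [Nat.sub_self, add_zero, zero_add, Nat.sub_zero, List.map_id'] at k1' k3'
  have e : ∀ (F₁ F₂ P P' : List (Paren α)), F₁.length + P'.length +
      ((F₁ ++ P ++ F₂).length - (F₁.length + P.length)) = (F₁ ++ P' ++ F₂).length := by
    intro F₁ F₂ P P'; simp; omega
  rw [e, e] at k3'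
  refine ⟨_, _, (k1'.append k2).append k3', ?_, fun u v => ?_⟩
  · rw [add_zero]; exact add_le_add l1 l3
  · rw [List.mem_append, List.mem_append, m1, m2, or_assoc]
    have b1 := h1.mem_bounds
    have b2 := h2.mem_bounds
    refine or_congr ?_ (or_congr Iff.rfl ?_)
    · rw [List.mem_append]
      refine ⟨fun h => ⟨Or.inl h.1, h.2⟩, fun h => ⟨h.1.resolve_right fun h' => ?_, h.2⟩⟩
      have := b2 u v h'; omega
    · simp only [List.mem_map, Prod.mk.injEq, Prod.exists, m3, List.mem_append]
      constructor
      · rintro ⟨a, b, ⟨hm, ha, hb⟩, rfl, rfl⟩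
        refine ⟨a - (F₁.length + P.length), b - (G₁.length + P.length), rfl, rfl, Or.inr ?_⟩
        rwa [Nat.add_sub_cancel' ha, Nat.add_sub_cancel' hb]
      · rintro ⟨m, m', rfl, rfl, hm⟩
        refine ⟨_, _, ⟨hm.resolve_left fun h' => ?_, Nat.le_add_right _ _, Nat.le_add_right _ _⟩,
          by simp, by simp⟩
        have := b1 _ _ h'; omega

end

section
variable {α : Type*} {w : Option α → Option α → ℝ≥0} {X Y : List (Paren α)}
  {x y x' y' x'' y'' : ℕ} {M M' : List (ℕ × ℕ)} {c c' : ℝ≥0}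

/-! ### Walks and alignments -/

theorem exists_walk_of_chain (w : Option α → Option α → ℝ≥0) (X Y : List (Paren α)) :
    ∀ (A : List (ℕ × ℕ)) (p : ℕ × ℕ), (p :: A).getLast? = some (x', y') →
      (p :: A).IsChain (AlignEdge X.length Y.length) →
      ∃ M, Walk w X Y p.1 p.2 x' y' M (alignmentCost w X Y (p :: A)) ∧
        ∀ u v, (u, v) ∈ M ↔ Aligns (p :: A) u v := by
  intro A
  induction A with
  | nil =>
    intro p hp _
    simp only [List.getLast?_singleton, Option.some.injEq] at hp
    subst hp
    refine ⟨[], by simpa [alignmentCost] using Walk.nil x' y', fun u v => ?_⟩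
    simp [Aligns, List.infix_cons_iff]
  | cons q A ih =>
    rintro ⟨x, y⟩ hp hc
    rw [List.isChain_cons_cons] at hc
    rw [List.getLast?_cons_cons] at hp
    obtain ⟨M, hM, hm⟩ := ih q hp hc.2
    have hcost : alignmentCost w X Y ((x, y) :: q :: A)
        = edgeCost w X Y (x, y) q + alignmentCost w X Y (q :: A) := by
      simp [alignmentCost]
    have hal : ∀ u v, Aligns ((x, y) :: q :: A) u v ↔
        ((u = x ∧ v = y) ∧ q = (u + 1, v + 1)) ∨ Aligns (q :: A) u v := by
      intro u v
      simp only [Aligns]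
      rw [List.infix_cons_iff]
      simp [List.cons_prefix_cons, eq_comm]
    rw [hcost]
    rcases hc.1 with ⟨rfl, h1, h2⟩ | ⟨rfl, h1, h2⟩ | ⟨rfl, h1, h2⟩ <;> simp only at h1 h2 hM
    · refine ⟨M, ?_, fun u v => ?_⟩
      · have : edgeCost w X Y (x, y) (x + 1, y) = halfWeight w (some X[x]) none := by
          simp [edgeCost, List.getElem?_eq_getElem h1]
        rw [this]
        exact .del (List.getElem?_eq_getElem h1) hM
      · rw [hal, hm]; simp; omega
    · refine ⟨M, ?_, fun u v => ?_⟩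
      · have : edgeCost w X Y (x, y) (x, y + 1) = halfWeight w none (some Y[y]) := by
          simp [edgeCost, List.getElem?_eq_getElem h2]
        rw [this]
        exact .ins (List.getElem?_eq_getElem h2) hM
      · rw [hal, hm]; simp; omega
    · refine ⟨(x, y) :: M, ?_, fun u v => ?_⟩
      · have : edgeCost w X Y (x, y) (x + 1, y + 1) = halfWeight w (some X[x]) (some Y[y]) := by
          simp [edgeCost, List.getElem?_eq_getElem h2, List.getElem?_eq_getElem h1]
        rw [this]
        exact .diag (List.getElem?_eq_getElem h1) (List.getElem?_eq_getElem h2) hM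
      · rw [hal, List.mem_cons, hm]
        simp only [Prod.mk.injEq]
        constructor
        · rintro (⟨rfl, rfl⟩ | h)
          · exact Or.inl ⟨⟨rfl, rfl⟩, rfl, rfl⟩
          · exact Or.inr h
        · rintro (h | h)
          · exact Or.inl h.1
          · exact Or.inr h

theorem Walk.exists_chain (h : Walk w X Y x y x' y' M c) (hx : x' ≤ X.length)
    (hy : y' ≤ Y.length) :
    ∃ A, ((x, y) :: A).getLast? = some (x', y') ∧
      ((x, y) :: A).IsChain (AlignEdge X.length Y.length) ∧
      alignmentCost w X Y ((x, y) :: A) = c ∧ ∀ u v, (u, v) ∈ M ↔ Aligns ((x, y) :: A) u v := by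
  have hcost : ∀ p q A, alignmentCost w X Y (p :: q :: A)
      = edgeCost w X Y p q + alignmentCost w X Y (q :: A) := by
    intro p q A; simp [alignmentCost]
  have hal : ∀ p q A u v, Aligns (p :: q :: A) u v ↔
      (p = (u, v) ∧ q = (u + 1, v + 1)) ∨ Aligns (q :: A) u v := by
    intro p q A u v
    simp only [Aligns]
    rw [List.infix_cons_iff]
    simp [List.cons_prefix_cons, eq_comm]
  induction h with
  | nil x y => exact ⟨[], by simp, by simp, by simp [alignmentCost], by
      simp [Aligns, List.infix_cons_iff]⟩
  | @del x y x' y' M c a ha h ih =>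
    obtain ⟨A, h1, h2, h3, h4⟩ := ih hx hy
    have hl := h.le
    refine ⟨(x + 1, y) :: A, by rwa [List.getLast?_cons_cons],
      List.isChain_cons_cons.2 ⟨Or.inl ⟨rfl, ?_, ?_⟩, h2⟩, ?_, fun u v => ?_⟩
    · simp only; omega
    · simp only; omega
    · rw [hcost, h3]; simp [edgeCost, ha]
    · rw [hal, h4]; simp; omega
  | @ins x y x' y' M c a ha h ih =>
    obtain ⟨A, h1, h2, h3, h4⟩ := ih hx hy
    have hl := h.le
    refine ⟨(x, y + 1) :: A, by rwa [List.getLast?_cons_cons],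
      List.isChain_cons_cons.2 ⟨Or.inr (Or.inl ⟨rfl, ?_, ?_⟩), h2⟩, ?_, fun u v => ?_⟩
    · simp only; omega
    · simp only; omega
    · rw [hcost, h3]; simp [edgeCost, ha]
    · rw [hal, h4]; simp; omega
  | @diag x y x' y' M c a b ha hb h ih =>
    obtain ⟨A, h1, h2, h3, h4⟩ := ih hx hy
    have hl := h.le
    refine ⟨(x + 1, y + 1) :: A, by rwa [List.getLast?_cons_cons],
      List.isChain_cons_cons.2 ⟨Or.inr (Or.inr ⟨rfl, ?_, ?_⟩), h2⟩, ?_, fun u v => ?_⟩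
    · simp only; omega
    · simp only; omega
    · rw [hcost, h3]; simp [edgeCost, ha, hb]
    · rw [hal, ← h4, List.mem_cons]
      simp only [Prod.mk.injEq]
      constructor
      · rintro (⟨rfl, rfl⟩ | h)
        · exact Or.inl ⟨⟨rfl, rfl⟩, rfl, rfl⟩
        · exact Or.inr h
      · rintro (⟨⟨rfl, rfl⟩, -⟩ | h)
        · exact Or.inl ⟨rfl, rfl⟩
        · exact Or.inr h

/-- A set of aligned pairs is compatible with the tree structure. -/
def MateClosed (X Y : List (Paren α)) (M : List (ℕ × ℕ)) : Prop :=
  ∀ u v u' v', (u, v) ∈ M → IsMate X u u' → IsMate Y v v' → (u', v') ∈ M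

theorem IsForestAlignment.exists_walk (w : Option α → Option α → ℝ≥0) {A : List (ℕ × ℕ)}
    (h : IsForestAlignment X Y A) :
    ∃ M, Walk w X Y 0 0 X.length Y.length M (alignmentCost w X Y A) ∧ MateClosed X Y M := by
  obtain ⟨⟨hhead, hlast, hchain⟩, hm⟩ := h
  rcases A with - | ⟨p, A⟩
  · simp at hhead
  obtain rfl : p = (0, 0) := by simpa using hhead
  obtain ⟨M, h1, h2⟩ := exists_walk_of_chain w X Y A (0, 0) hlast hchain
  refine ⟨M, h1, fun u v u' v' => ?_⟩
  rw [h2, h2]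
  exact hm u v u' v'

theorem ted_le_of_walk (h : Walk w X Y 0 0 X.length Y.length M c) (hm : MateClosed X Y M) :
    ted w X Y ≤ c := by
  obtain ⟨A, h1, h2, h3, h4⟩ := h.exists_chain le_rfl le_rfl
  refine (iInf₂_le ((0, 0) :: A) ⟨⟨by simp, h1, h2⟩, fun u v u' v' => ?_⟩).trans_eq (by rw [h3])
  rw [← h4, ← h4]
  exact hm u v u' v'

/-! ### Forests that force cheap alignments onto the diagonal -/

/-- Cheap forest alignments of `F₁ P F₂` onto `G₁ P G₂` meet the main diagonal of `P`. -/
def ForcesDiagonal (k : ℕ) (P : List (Paren α)) : Prop :=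
  ∀ (w : Option α → Option α → ℝ≥0) (F₁ F₂ G₁ G₂ : List (Paren α)) (M : List (ℕ × ℕ)) (c : ℝ≥0),
    Normalized w → F₁.length ≤ G₁.length + 2 * k → G₁.length ≤ F₁.length + 2 * k →
    Walk w (F₁ ++ P ++ F₂) (G₁ ++ P ++ G₂) 0 0 (F₁ ++ P ++ F₂).length (G₁ ++ P ++ G₂).length M c →
    MateClosed (F₁ ++ P ++ F₂) (G₁ ++ P ++ G₂) M → 2 * c < 2 * k + 1 →
    ∃ t M₁ M₂ c₁ c₂, t ≤ P.length ∧
      Walk w (F₁ ++ P ++ F₂) (G₁ ++ P ++ G₂) 0 0 (F₁.length + t) (G₁.length + t) M₁ c₁ ∧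
      Walk w (F₁ ++ P ++ F₂) (G₁ ++ P ++ G₂) (F₁.length + t) (G₁.length + t)
        (F₁ ++ P ++ F₂).length (G₁ ++ P ++ G₂).length M₂ c₂ ∧ M = M₁ ++ M₂ ∧ c = c₁ + c₂

theorem ForcesDiagonal.ted_le {k : ℕ} {P P' : List (Paren α)} (hP : IsForest P)
    (hP' : IsForest P') (hf : ForcesDiagonal k P) (hn : Normalized w) (hq : IsQuasimetric w)
    {F₁ F₂ G₁ G₂ : List (Paren α)} (h1 : F₁.length ≤ G₁.length + 2 * k)
    (h2 : G₁.length ≤ F₁.length + 2 * k) {A : List (ℕ × ℕ)}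
    (hA : IsForestAlignment (F₁ ++ P ++ F₂) (G₁ ++ P ++ G₂) A)
    (hc : 2 * alignmentCost w (F₁ ++ P ++ F₂) (G₁ ++ P ++ G₂) A < 2 * k + 1) :
    ted w (F₁ ++ P' ++ F₂) (G₁ ++ P' ++ G₂)
      ≤ alignmentCost w (F₁ ++ P ++ F₂) (G₁ ++ P ++ G₂) A := by
  obtain ⟨M, hM, hm⟩ := hA.exists_walk w
  obtain ⟨t, M₁, M₂, c₁, c₂, ht, k1, k2, rfl, hcc⟩ := hf w F₁ F₂ G₁ G₂ M _ hn h1 h2 hM hm hc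
  obtain ⟨N, d, hN, hd, hmem⟩ := k1.replace hn hq P' ht k2
  rw [hcc]
  refine (ted_le_of_walk hN ?_).trans (ENNReal.coe_le_coe.2 hd)
  have hout : ∀ {a p q u : ℕ}, u < a ∨ a + p ≤ u → ∃ v, Outside a p q u v := by
    rintro a p q u (h | h)
    · exact ⟨u, Or.inl ⟨h, rfl⟩⟩
    · exact ⟨a + q + (u - (a + p)), Or.inr ⟨u - (a + p), by omega, rfl⟩⟩
  have key : ∀ u v u' v' u₀ v₀, (u₀, v₀) ∈ M₁ ++ M₂ →
      Outside F₁.length P'.length P.length u u₀ → Outside G₁.length P'.length P.length v v₀ →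
      IsMate (F₁ ++ P' ++ F₂) u u' → IsMate (G₁ ++ P' ++ G₂) v v' → (u', v') ∈ N := by
    intro u v u' v' u₀ v₀ h0 hu hv hmu hmv
    have o1 := hmu.outside hP' (by rcases hu with h | ⟨m, h⟩ <;> omega)
    have o2 := hmv.outside hP' (by rcases hv with h | ⟨m, h⟩ <;> omega)
    obtain ⟨u₁, hu₁⟩ := hout (q := P.length) o1
    obtain ⟨v₁, hv₁⟩ := hout (q := P.length) o2
    have h3 := hm _ _ _ _ h0 (hmu.replace hP' hP hu hu₁) (hmv.replace hP' hP hv hv₁)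
    -- The walk passes through the meeting point, so the coordinates of an aligned pair lie both
    -- before it or both after it. As `u₁` and `v₁` are outside the copies of `P`, they lie on the
    -- same side of these copies, and the pair survives the rerouting.
    have h4 : u₁ < F₁.length + t ↔ v₁ < G₁.length + t := by
      rcases List.mem_append.1 h3 with h | h
      · have := k1.mem_bounds _ _ h; omega
      · have := k2.mem_bounds _ _ h; omega
    rw [hmem]
    rcases hu₁ with ⟨a1, rfl⟩ | ⟨m, rfl, rfl⟩ <;> rcases hv₁ with ⟨a2, rfl⟩ | ⟨m', rfl, rfl⟩
    · exact Or.inl ⟨h3, a1, a2⟩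
    · omega
    · omega
    · exact Or.inr (Or.inr ⟨m, m', rfl, rfl, h3⟩)
  intro u v u' v' huv hmu hmv
  rcases (hmem u v).1 huv with ⟨h, hu, hv⟩ | ⟨s, hs, rfl, rfl⟩ | ⟨m, m', rfl, rfl, h⟩
  · exact key u v u' v' u v h (Or.inl ⟨hu, rfl⟩) (Or.inl ⟨hv, rfl⟩) hmu hmv
  · obtain ⟨m, hm'⟩ := hP'.exists_isMate s hs
    obtain rfl := (hm'.append F₁ F₂).unique hmu
    obtain rfl := (hm'.append G₁ G₂).unique hmv
    exact (hmem _ _).2 (Or.inr (Or.inl ⟨m, hm'.symm.lt_length, rfl, rfl⟩))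
  · exact key _ _ u' v' _ _ h (Or.inr ⟨m, rfl, rfl⟩) (Or.inr ⟨m', rfl, rfl⟩) hmu hmv

/-- The margin `1/2` above `k` makes it unnecessary to know that the infimum is attained: some
alignment `A` costs less than `k + 1/2`, cheap alignments are transferred directly, and the dear
ones are dominated by `A`. -/
theorem ForcesDiagonal.ted_le_ted {k : ℕ} {P P' : List (Paren α)} (hP : IsForest P)
    (hP' : IsForest P') (hf : ForcesDiagonal k P) (hn : Normalized w) (hq : IsQuasimetric w)
    {F₁ F₂ G₁ G₂ : List (Paren α)} (h1 : F₁.length ≤ G₁.length + 2 * k)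
    (h2 : G₁.length ≤ F₁.length + 2 * k) (h : ted w (F₁ ++ P ++ F₂) (G₁ ++ P ++ G₂) ≤ k) :
    ted w (F₁ ++ P' ++ F₂) (G₁ ++ P' ++ G₂) ≤ ted w (F₁ ++ P ++ F₂) (G₁ ++ P ++ G₂) := by
  have hlt : ted w (F₁ ++ P ++ F₂) (G₁ ++ P ++ G₂) < ((k + 1 / 2 : ℝ≥0) : ℝ≥0∞) := by
    refine h.trans_lt ?_
    rw [← ENNReal.coe_natCast, ENNReal.coe_lt_coe]
    exact lt_add_of_pos_right _ (by norm_num)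
  have hhalf : ∀ c : ℝ≥0, c < k + 1 / 2 → 2 * c < 2 * k + 1 := by
    intro c hc
    calc 2 * c < 2 * (k + 1 / 2) := by gcongr
      _ = 2 * k + 1 := by ring
  obtain ⟨A, hA⟩ := iInf_lt_iff.1 hlt
  obtain ⟨hA, hcA⟩ := iInf_lt_iff.1 hA
  rw [ENNReal.coe_lt_coe] at hcA
  refine le_iInf₂ fun B hB => ?_
  rcases lt_or_ge (alignmentCost w (F₁ ++ P ++ F₂) (G₁ ++ P ++ G₂) B) (k + 1 / 2) with hB' | hB'
  · exact hf.ted_le hP hP' hn hq h1 h2 hB (hhalf _ hB')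
  · exact (hf.ted_le hP hP' hn hq h1 h2 hA (hhalf _ hcA)).trans
      (ENNReal.coe_le_coe.2 (hcA.le.trans hB'))

theorem ForcesDiagonal.tedEquivalent {k : ℕ} {P P' : List (Paren α)} (hP : IsForest P)
    (hP' : IsForest P') (hf : ForcesDiagonal k P) (hf' : ForcesDiagonal k P')
    (hn : Normalized w) (hq : IsQuasimetric w) : TedEquivalent k w P P' := by
  intro F₁ F₂ G₁ G₂ _ _ h1 h2
  unfold tedLe
  by_cases h : ted w (F₁ ++ P ++ F₂) (G₁ ++ P ++ G₂) ≤ k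
  · have h3 := hf.ted_le_ted hP hP' hn hq h1 h2 h
    have h4 := hf'.ted_le_ted hP' hP hn hq h1 h2 (h3.trans h)
    rw [if_pos h, if_pos (h3.trans h)]
    exact le_antisymm h4 h3
  · rw [if_neg h, if_neg fun h' => h ((hf'.ted_le_ted hP' hP hn hq h1 h2 h').trans h')]

end

section
variable {α : Type*} {w : Option α → Option α → ℝ≥0} {X Y : List (Paren α)}
  {x y x' y' : ℕ} {M : List (ℕ × ℕ)} {c : ℝ≥0}

/-! ### Walks of small cost -/

theorem half_le_halfWeight (hn : Normalized w) {p q : Option (Paren α)}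
    (h : p.map Paren.label ≠ q.map Paren.label) : 1 ≤ 2 * halfWeight w p q := by
  unfold halfWeight
  rw [mul_div_cancel₀ _ two_ne_zero]
  exact hn.2 _ _ h

/-- Only deletions and insertions change the diagonal, each by one step and at a cost of at least
`1/2`. -/
theorem Walk.shift_le (hn : Normalized w) (h : Walk w X Y x y x' y' M c) :
    ∃ n : ℕ, (n : ℝ≥0) ≤ 2 * c ∧ y' + x ≤ x' + y + n ∧ x' + y ≤ y' + x + n := by
  induction h with
  | nil x y => exact ⟨0, by simp, by omega, by omega⟩
  | @del x y x' y' M c a ha h ih =>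
    obtain ⟨n, h1, h2, h3⟩ := ih
    refine ⟨n + 1, ?_, by omega, by omega⟩
    have := half_le_halfWeight hn (p := some a) (q := none) (by simp)
    push_cast; rw [mul_add, add_comm]; exact add_le_add this h1
  | @ins x y x' y' M c a ha h ih =>
    obtain ⟨n, h1, h2, h3⟩ := ih
    refine ⟨n + 1, ?_, by omega, by omega⟩
    have := half_le_halfWeight hn (p := none) (q := some a) (by simp)
    push_cast; rw [mul_add, add_comm]; exact add_le_add this h1
  | @diag x y x' y' M c a b ha hb h ih =>
    obtain ⟨n, h1, h2, h3⟩ := ih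
    refine ⟨n, h1.trans ?_, by omega, by omega⟩
    gcongr
    exact le_add_self

/-- A walk of cost less than `1/2` aligns only characters with equal labels. -/
theorem Walk.diagonal_of_lt (hn : Normalized w) (h : Walk w X Y x y x' y' M c) (hc : 2 * c < 1) :
    ∀ s, x + s < x' → (x + s, y + s) ∈ M ∧
      ∃ a b, X[x + s]? = some a ∧ Y[y + s]? = some b ∧ a.label = b.label := by
  induction h with
  | nil x y => intro s hs; omega
  | @del x y x' y' M c a ha h ih =>
    have := half_le_halfWeight hn (p := some a) (q := none) (by simp)
    rw [mul_add] at hc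
    exact absurd (this.trans le_self_add) (not_le.2 hc)
  | @ins x y x' y' M c a ha h ih =>
    have := half_le_halfWeight hn (p := none) (q := some a) (by simp)
    rw [mul_add] at hc
    exact absurd (this.trans le_self_add) (not_le.2 hc)
  | @diag x y x' y' M c a b ha hb h ih =>
    have hab : a.label = b.label := by
      by_contra hne
      have := half_le_halfWeight hn (p := some a) (q := some b) (by simpa using hne)
      rw [mul_add] at hc
      exact absurd (this.trans le_self_add) (not_le.2 hc)
    rw [mul_add] at hc
    have ih' := ih (lt_of_le_of_lt le_add_self hc)
    intro s hs
    rcases s with - | s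
    · exact ⟨List.mem_cons_self, a, b, ha, hb, hab⟩
    · obtain ⟨h1, h2⟩ := ih' s (by omega)
      rw [show x + (s + 1) = x + 1 + s by ring, show y + (s + 1) = y + 1 + s by ring]
      exact ⟨List.mem_cons_of_mem _ h1, h2⟩

/-- A walk from one side of a diagonal to the other meets this diagonal. -/
theorem Walk.exists_meet (h : Walk w X Y x y x' y' M c) {f g : ℕ}
    (hd : (x + g ≤ y + f ∧ y' + f ≤ x' + g) ∨ (y + f ≤ x + g ∧ x' + g ≤ y' + f)) :
    ∃ u v M₁ M₂ c₁ c₂, Walk w X Y x y u v M₁ c₁ ∧ Walk w X Y u v x' y' M₂ c₂ ∧ M = M₁ ++ M₂ ∧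
      c = c₁ + c₂ ∧ u + g = v + f := by
  by_cases he : x + g = y + f
  · exact ⟨x, y, [], M, 0, c, .nil _ _, h, rfl, by simp, he⟩
  induction h with
  | nil x y => omega
  | @del x y x' y' M c a ha h ih =>
    by_cases h1 : x + 1 + g = y + f
    · exact ⟨x + 1, y, [], M, _, c, .del ha (.nil _ _), h, rfl, by simp, h1⟩
    obtain ⟨u, v, M₁, M₂, c₁, c₂, h3, h4, rfl, rfl, h5⟩ := ih (by omega) h1
    exact ⟨u, v, M₁, M₂, _, c₂, .del ha h3, h4, rfl, (add_assoc _ _ _).symm, h5⟩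
  | @ins x y x' y' M c a ha h ih =>
    by_cases h1 : x + g = y + 1 + f
    · exact ⟨x, y + 1, [], M, _, c, .ins ha (.nil _ _), h, rfl, by simp, h1⟩
    obtain ⟨u, v, M₁, M₂, c₁, c₂, h3, h4, rfl, rfl, h5⟩ := ih (by omega) h1
    exact ⟨u, v, M₁, M₂, _, c₂, .ins ha h3, h4, rfl, (add_assoc _ _ _).symm, h5⟩
  | @diag x y x' y' M c a b ha hb h ih =>
    obtain ⟨u, v, M₁, M₂, c₁, c₂, h3, h4, rfl, rfl, h5⟩ := ih (by omega) (by omega)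
    exact ⟨u, v, _, M₂, _, c₂, .diag ha hb h3, h4, rfl, (add_assoc _ _ _).symm, h5⟩

/-- Between two aligned pairs on different sides of a diagonal, in whichever order they are visited,
the walk meets the diagonal. The meeting point has its first coordinate between those of the pairs,
hence in the prescribed range. -/
theorem Walk.meet_of_mem (h : Walk w X Y x y x' y' M c) {f g n u₁ v₁ u₂ v₂ : ℕ}
    (h1 : (u₁, v₁) ∈ M) (h2 : (u₂, v₂) ∈ M) (hd1 : u₁ + g < v₁ + f) (hd2 : v₂ + f < u₂ + g)
    (hu1 : f ≤ u₁ ∧ u₁ ≤ f + n) (hu2 : f ≤ u₂ ∧ u₂ ≤ f + n) :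
    ∃ t M₁ M₂ c₁ c₂, t ≤ n ∧ Walk w X Y x y (f + t) (g + t) M₁ c₁ ∧
      Walk w X Y (f + t) (g + t) x' y' M₂ c₂ ∧ M = M₁ ++ M₂ ∧ c = c₁ + c₂ := by
  have main : ∀ u₁ v₁ u₂ v₂, (u₁, v₁) ∈ M → (u₂, v₂) ∈ M → u₁ < u₂ →
      ((u₁ + g ≤ v₁ + f ∧ v₂ + f ≤ u₂ + g) ∨ (v₁ + f ≤ u₁ + g ∧ u₂ + g ≤ v₂ + f)) →
      f ≤ u₁ → u₂ ≤ f + n →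
      ∃ t M₁ M₂ c₁ c₂, t ≤ n ∧ Walk w X Y x y (f + t) (g + t) M₁ c₁ ∧
        Walk w X Y (f + t) (g + t) x' y' M₂ c₂ ∧ M = M₁ ++ M₂ ∧ c = c₁ + c₂ := by
    intro u₁ v₁ u₂ v₂ h1 h2 hlt hd hu1 hu2
    obtain ⟨M₁, M₂, c₁, c₂, -, -, -, -, k1, k2, rfl, rfl, -⟩ := h.mem_split _ _ h1
    have h2' : (u₂, v₂) ∈ M₂ := (List.mem_append.1 h2).resolve_left fun h' => by
      have := k1.mem_bounds _ _ h'; omega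
    obtain ⟨N₁, N₂, d₁, d₂, -, -, -, -, l1, l2, rfl, rfl, -⟩ := k2.mem_split _ _ h2'
    obtain ⟨u, v, L₁, L₂, e₁, e₂, m1, m2, rfl, rfl, hm⟩ := l1.exists_meet hd
    have b1 := m1.le
    have b2 := m2.le
    obtain ⟨t, rfl⟩ : ∃ t, u = f + t := ⟨u - f, by omega⟩
    obtain rfl : v = g + t := by omega
    exact ⟨t, _, _, _, _, by omega, k1.append m1, m2.append l2, by simp, by ring⟩
  have hiff := h.lt_iff h1 h2
  have hiff' := h.lt_iff h2 h1
  rcases Nat.lt_or_ge u₁ u₂ with hl | hl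
  · exact main _ _ _ _ h1 h2 hl (Or.inl ⟨hd1.le, hd2.le⟩) hu1.1 hu2.2
  · exact main _ _ _ _ h2 h1 (by omega) (Or.inr ⟨hd2.le, hd1.le⟩) hu2.1 hu1.2

/-! ### Periodic fragments with a balanced period -/

/-- The fragment `P[l .. r)` has a period of length at most `4k`, which is balanced if it occurs
at least twice. -/
def ShortBalancedPeriod (k : ℕ) (P : List (Paren α)) (l r : ℕ) : Prop :=
  ∃ p, 1 ≤ p ∧ p ≤ 4 * k ∧ PeriodicOn P l r p ∧
    (l + 2 * p ≤ r → height P (l + p) = height P l)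

/-- The prefix `P[0 .. i)` is divided into `m` fragments without short balanced periods. -/
inductive Phrases (k : ℕ) (P : List (Paren α)) : ℕ → ℕ → Prop
  | zero : Phrases k P 0 0
  | succ {m i r : ℕ} (h : Phrases k P m i) (hir : i ≤ r) (hr : r ≤ P.length)
      (hP : ¬ ShortBalancedPeriod k P i r) : Phrases k P (m + 1) r

/-! ### Many phrases force the diagonal -/

theorem Phrases.le {k : ℕ} {P : List (Paren α)} {m i : ℕ} (h : Phrases k P m i) :
    i ≤ P.length := by
  cases h <;> omega

/-- Costs see only labels. The kinds agree because the mates are aligned too and walks preserve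
order, so both mates come later or both come earlier. -/
theorem isOpen_eq_of_mates {P : List (Paren α)} (hP : IsForest P) {F₁ F₂ G₁ G₂ : List (Paren α)}
    (h : Walk w (F₁ ++ P ++ F₂) (G₁ ++ P ++ G₂) x y x' y' M c)
    (hm : MateClosed (F₁ ++ P ++ F₂) (G₁ ++ P ++ G₂) M) {u v : ℕ} {a b : Paren α}
    (hu : P[u]? = some a) (hv : P[v]? = some b) (huv : (F₁.length + u, G₁.length + v) ∈ M) :
    a.isOpen = b.isOpen := by
  obtain ⟨u', hu'⟩ := hP.exists_isMate u (List.getElem?_eq_some_iff.1 hu).1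
  obtain ⟨v', hv'⟩ := hP.exists_isMate v (List.getElem?_eq_some_iff.1 hv).1
  have h1 := hm _ _ _ _ huv (hu'.append F₁ F₂) (hv'.append G₁ G₂)
  have h2 := h.lt_iff huv h1
  rcases hu' with n1 | n1 <;> rcases hv' with n2 | n2 <;>
    obtain ⟨l1, ⟨a1, o1⟩, ⟨b1, e1⟩, -⟩ := n1 <;> obtain ⟨l2, ⟨a2, o2⟩, ⟨b2, e2⟩, -⟩ := n2
  · rw [hu] at o1; rw [hv] at o2; simp at o1 o2; simp [o1, o2]
  · omega
  · omega
  · rw [hu] at e1; rw [hv] at e2; simp at e1 e2; simp [e1, e2]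

theorem Paren.ext' {a b : Paren α} (h1 : a.isOpen = b.isOpen) (h2 : a.label = b.label) : a = b := by
  cases a; cases b; simp_all

theorem Phrases.forcesDiagonal {k m i : ℕ} {P : List (Paren α)} (hP : IsForest P)
    (hph : Phrases k P m i) (hkm : 2 * k < m) : ForcesDiagonal k P := by
  intro w F₁ F₂ G₁ G₂ M c hn hl1 hl2 h hm hc
  set X := F₁ ++ P ++ F₂ with hX
  set Y := G₁ ++ P ++ G₂ with hY
  by_contra hcon
  have hmeet : ∀ u v M₁ M₂ c₁ c₂, Walk w X Y 0 0 (F₁.length + u) (G₁.length + v) M₁ c₁ →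
      Walk w X Y (F₁.length + u) (G₁.length + v) X.length Y.length M₂ c₂ → M = M₁ ++ M₂ →
      c = c₁ + c₂ → u ≤ P.length → u ≠ v := by
    rintro u v M₁ M₂ c₁ c₂ h1 h2 h3 h4 h5 rfl
    exact hcon ⟨u, M₁, M₂, c₁, c₂, h5, h1, h2, h3, h4⟩
  have hcross : ∀ u₁ v₁ u₂ v₂, (F₁.length + u₁, G₁.length + v₁) ∈ M →
      (F₁.length + u₂, G₁.length + v₂) ∈ M → u₁ < v₁ → v₂ < u₂ → u₁ ≤ P.length →
      u₂ ≤ P.length → False := by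
    intro u₁ v₁ u₂ v₂ h1 h2 h3 h4 h5 h6
    obtain ⟨t, M₁, M₂, c₁, c₂, k1⟩ := h.meet_of_mem (f := F₁.length) (g := G₁.length)
      (n := P.length) h1 h2 (by omega) (by omega) (by omega) (by omega)
    exact hcon ⟨t, M₁, M₂, c₁, c₂, k1⟩
  have hXlen : X.length = F₁.length + P.length + F₂.length := by simp [hX]; ring
  -- Unless the diagonal is met, every phrase costs at least `1/2`. For more than `2k` phrases this
  -- exceeds the allowed cost.
  have claim : ∀ m i, Phrases k P m i → ∀ v M₁ M₂ c₁ c₂,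
      Walk w X Y 0 0 (F₁.length + i) v M₁ c₁ →
      Walk w X Y (F₁.length + i) v X.length Y.length M₂ c₂ → M = M₁ ++ M₂ →
      c = c₁ + c₂ → (m : ℝ≥0) ≤ 2 * c₁ := by
    intro m i hph
    induction hph with
    | zero => intros; simp
    | @succ m i r hph hir hr hnP ih =>
      intro v' M₁ M₂ c₁ c₂ h1 h2 h3 h4
      obtain ⟨v, N₁, N₂, d₁, d₂, k1, k2, rfl, rfl⟩ :=
        h1.split_x (f := F₁.length + i) (Nat.zero_le _) (by omega)
      have hm1 := ih v N₁ (N₂ ++ M₂) d₁ (d₂ + c₂) k1 (k2.append h2) (by simp [h3])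
        (by rw [h4, add_assoc])
      suffices hd : 1 ≤ 2 * d₂ by
        push_cast; rw [mul_add]; exact add_le_add hm1 hd
      by_contra! hd
      have hdiag := k2.diagonal_of_lt hn hd
      obtain ⟨n, hn1, hn2, hn3⟩ := k1.shift_le hn
      -- The walk has drifted by at most `2k` so far. With the offset of the copies of `P`, the
      -- shift `d` below is at most `4k`.
      have hn4 : n ≤ 2 * k := by
        have : (n : ℝ≥0) < 2 * k + 1 := by
          refine (hn1.trans ?_).trans_lt hc
          rw [h4, add_assoc]; gcongr; exact le_self_add
        have : n < 2 * k + 1 := by exact_mod_cast this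
        omega
      have hmem : ∀ s, i + s < r → (F₁.length + (i + s), v + s) ∈ M := by
        intro s hs
        have := (hdiag s (by omega)).1
        rw [add_assoc] at this
        rw [h3]; simp [this]
      have hchar : ∀ s z, i + s < r → z < P.length → v + s = G₁.length + z →
          P[i + s]? = P[z]? := by
        intro s z hs hz hsz
        obtain ⟨a, b, ha, hb, hab⟩ := (hdiag s (by omega)).2
        rw [add_assoc, hX, getElem?_mid (by omega)] at ha
        rw [hsz, hY, getElem?_mid (by omega)] at hb
        have hmm := hmem s hs
        rw [hsz] at hmm
        rw [ha, hb, Paren.ext' (isOpen_eq_of_mates hP h hm ha hb hmm) hab]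
      rcases lt_trichotomy v (G₁.length + i) with hlt | heq | hgt
      · obtain ⟨d, hd⟩ : ∃ d, v + d = G₁.length + i := ⟨G₁.length + i - v, by omega⟩
        have hper : PeriodicOn P i r d := by
          intro x hx hxr
          have := hchar (x - i + d) x (by omega) (by omega) (by omega)
          rw [← this]; congr 1; omega
        refine hnP ⟨d, by omega, by omega, hper, fun h5 => ?_⟩
        by_contra hne
        obtain ⟨x, m, m', hx, hxr, q1, q2, q3⟩ :=
          exists_crossing_mates hP (by omega) hper hr h5 hne
        -- Position `x + d` is aligned to `x`, so its mate `m'` is aligned to the mate `m` of `x`.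
        -- As `m' < m`, these two pairs are on different sides of the diagonal.
        have h6 := hmem (x - i + d) (by omega)
        rw [show i + (x - i + d) = x + d by omega, show v + (x - i + d) = G₁.length + x by omega]
          at h6
        have h7 := hm _ _ _ _ h6 (q2.append F₁ F₂) (q1.append G₁ G₂)
        have := q2.symm.lt_length
        exact hcross _ _ _ _ h7 h6 q3 (by omega) (by omega) (by omega)
      · rw [heq] at k1 k2
        exact hmeet _ _ _ _ _ _ k1 (k2.append h2) (by simp [h3]) (by rw [h4, add_assoc])
          (by omega) rfl
      · obtain ⟨d, hd⟩ : ∃ d, v = G₁.length + i + d := ⟨v - (G₁.length + i), by omega⟩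
        have hper : PeriodicOn P i r d := by
          intro x hx hxr
          have := hchar (x - i) (x + d) (by omega) (by omega) (by omega)
          rw [← this]; congr 1; omega
        refine hnP ⟨d, by omega, by omega, hper, fun h5 => ?_⟩
        by_contra hne
        obtain ⟨x, m, m', hx, hxr, q1, q2, q3⟩ :=
          exists_crossing_mates hP (by omega) hper hr h5 hne
        have h6 := hmem (x - i) (by omega)
        rw [show i + (x - i) = x by omega, show v + (x - i) = G₁.length + (x + d) by omega]
          at h6
        have h7 := hm _ _ _ _ h6 (q1.append F₁ F₂) (q2.append G₁ G₂)
        have := q1.symm.lt_length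
        exact hcross _ _ _ _ h6 h7 (by omega) q3 (by omega) (by omega)
  have hi := hph.le
  obtain ⟨v, M₁, M₂, c₁, c₂, k1, k2, k3, k4⟩ :=
    h.split_x (f := F₁.length + i) (Nat.zero_le _) (by omega)
  have h1 := claim m i hph v M₁ M₂ c₁ c₂ k1 k2 k3 k4
  have h2 : (m : ℝ≥0) < 2 * k + 1 := by
    refine (h1.trans ?_).trans_lt hc
    rw [k4]; gcongr; exact le_self_add
  have h3 : m < 2 * k + 1 := by exact_mod_cast h2
  omega

end

section
variable {α : Type*}

/-! ### Counting red characters -/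

/-- The number of red characters in `P[l .. r)`. -/
noncomputable def redCount (k : ℕ) (P : List (Paren α)) (l r : ℕ) : ℕ :=
  (red k P ∩ Finset.Ico l r).card

theorem redCount_le_add (k : ℕ) (P : List (Paren α)) (l m r : ℕ) :
    redCount k P l r ≤ redCount k P l m + redCount k P m r := by
  unfold redCount
  refine (Finset.card_le_card ?_).trans (Finset.card_union_le _ _)
  intro x hx
  simp only [Finset.mem_inter, Finset.mem_Ico, Finset.mem_union] at hx ⊢
  rcases Nat.lt_or_ge x m with h | h
  · exact Or.inl ⟨hx.1, hx.2.1, h⟩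
  · exact Or.inr ⟨hx.1, h, hx.2.2⟩

theorem redCount_le_sub (k : ℕ) (P : List (Paren α)) (l r : ℕ) : redCount k P l r ≤ r - l :=
  (Finset.card_le_card Finset.inter_subset_right).trans (by simp)

theorem card_red_eq (k : ℕ) (P : List (Paren α)) : (red k P).card = redCount k P 0 P.length := by
  unfold redCount
  congr 1
  refine (Finset.inter_eq_left.2 fun x hx => ?_).symm
  simp only [red, Finset.mem_filter, Finset.mem_range] at hx
  simpa using hx.1

theorem card_red_le (k : ℕ) (P : List (Paren α)) : (red k P).card ≤ P.length :=
  (card_red_eq k P).trans_le ((redCount_le_sub k P 0 P.length).trans (by simp))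

theorem isPeriodicBlock_fragment {k : ℕ} {P : List (Paren α)} {l r p : ℕ} (hp : 1 ≤ p)
    (hpk : p ≤ 4 * k) (h : PeriodicOn P l r p) (hr : r ≤ P.length) (hlen : 42 * k ≤ r - l)
    (hb : height P (l + p) = height P l) : IsPeriodicBlock k (fragment P l r) := by
  have hl := fragment_length P (l := l) hr
  refine ⟨by omega, p, hpk, ⟨hp, by omega, fun i hi => ?_⟩, ?_⟩
  · rw [fragment_getElem? P (by omega), fragment_getElem? P (by omega), h (l + i) (by omega)
      (by omega), add_assoc]
  · have h1 := height_fragment P (x := p) (l := l) (r := r) (by omega) hr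
    rw [hb, sub_self] at h1
    unfold height openCount at h1
    have h2 := List.length_eq_countP_add_countP (fun c : Paren α => c.isOpen)
      (l := (fragment P l r).take p)
    rw [List.length_take, hl, min_eq_left (by omega)] at h2
    have h3 : (fun a : Paren α => decide (¬ a.isOpen = true)) = fun c => !c.isOpen := by
      funext a; cases a.isOpen <;> simp
    rw [h3] at h2
    unfold EquallyMany
    omega

/-- Either the fragment is shorter than `42k`, or it is a periodic block and only its outer `5k`
characters at each end can be red. -/
theorem ShortBalancedPeriod.redCount_le {k : ℕ} {P : List (Paren α)} {l r : ℕ}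
    (h : ShortBalancedPeriod k P l r) (hr : r ≤ P.length) : redCount k P l r ≤ 42 * k := by
  obtain ⟨p, hp, hpk, hper, hb⟩ := h
  rcases Nat.lt_or_ge (r - l) (42 * k) with hlt | hge
  · exact (redCount_le_sub k P l r).trans hlt.le
  · have hblock := isPeriodicBlock_fragment hp hpk hper hr hge (hb (by omega))
    have hsub : red k P ∩ Finset.Ico l r ⊆
        Finset.Ico l (l + 5 * k) ∪ Finset.Ico (r - 5 * k) r := by
      intro x hx
      simp only [red, Finset.mem_inter, Finset.mem_Ico, Finset.mem_union, Finset.mem_filter]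
        at hx ⊢
      by_contra! hc
      exact hx.1.2 ⟨l, r, by omega, hr, hblock, by omega, by omega⟩
    refine (Finset.card_le_card hsub).trans ((Finset.card_union_le _ _).trans ?_)
    simp only [Nat.card_Ico]
    omega

/-- Greedy division into shortest phrases: without its last character such a phrase has a short
balanced period, so it contributes at most `42k + 1` red characters. -/
theorem exists_phrases_or_redCount_le {k : ℕ} (hk : 0 < k) (P : List (Paren α)) (N : ℕ) :
    ∀ m i, Phrases k P m i → (∃ j, Phrases k P (m + N) j) ∨
      redCount k P i P.length ≤ N * (42 * k + 1) := by
  induction N with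
  | zero => exact fun m i h => Or.inl ⟨i, h⟩
  | succ N ih =>
    intro m i h
    classical
    by_cases hex : ∃ r, i ≤ r ∧ r ≤ P.length ∧ ¬ ShortBalancedPeriod k P i r
    · obtain ⟨h1, h2, h3⟩ := Nat.find_spec hex
      have hmin := fun s => Nat.find_min hex (m := s)
      generalize Nat.find hex = r at h1 h2 h3 hmin
      have hir : i < r := by
        refine lt_of_le_of_ne h1 ?_
        rintro rfl
        exact h3 ⟨1, le_rfl, by omega, fun x hx hx' => by omega, fun h => by omega⟩
      have hS : ShortBalancedPeriod k P i (r - 1) := by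
        by_contra hc
        exact hmin (r - 1) (by omega) ⟨by omega, by omega, hc⟩
      rcases ih (m + 1) r (h.succ h1 h2 h3) with ⟨j, hj⟩ | hred
      · exact Or.inl ⟨j, by rwa [show m + (N + 1) = m + 1 + N by ring]⟩
      · right
        have e1 := redCount_le_add k P i r P.length
        have e2 := redCount_le_add k P i (r - 1) r
        have e3 := hS.redCount_le (by omega)
        have e4 := redCount_le_sub k P (r - 1) r
        rw [add_mul]
        omega
    · right
      push Not at hex
      have := (hex P.length h.le le_rfl).redCount_le le_rfl
      rw [add_mul]
      omega

theorem exists_phrases_of_red {k : ℕ} (hk : 0 < k) {P : List (Paren α)}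
    (h : 158 * k ^ 2 ≤ (red k P).card) : ∃ j, Phrases k P (2 * k + 1) j := by
  rcases exists_phrases_or_redCount_le hk P (2 * k + 1) 0 0 .zero with ⟨j, hj⟩ | h1
  · exact ⟨j, by rwa [zero_add] at hj⟩
  · rw [← card_red_eq] at h1
    -- `(2k + 1)(42k + 1) = 84k² + 44k + 1 ≤ 129k² < 158k²`.
    nlinarith

theorem IsForest.forcesDiagonal_of_red {k : ℕ} (hk : 0 < k) {P : List (Paren α)} (hP : IsForest P)
    (h : 158 * k ^ 2 ≤ (red k P).card) : ForcesDiagonal k P :=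
  let ⟨_, hj⟩ := exists_phrases_of_red hk h
  hj.forcesDiagonal hP (by omega)

/-! ### Towers -/

/-- The forest that consists of `N` nested nodes with label `a`. -/
def tower (a : α) (N : ℕ) : List (Paren α) :=
  List.replicate N ⟨true, a⟩ ++ List.replicate N ⟨false, a⟩

theorem isForest_tower (a : α) (N : ℕ) : IsForest (tower a N) := by
  induction N with
  | zero => exact .nil
  | succ N ih =>
    have := ih.node a
    rw [tower, List.replicate_succ (a := (⟨true, a⟩ : Paren α)), List.replicate_succ']
    simpa [tower] using this

theorem length_tower (a : α) (N : ℕ) : (tower a N).length = 2 * N := by simp [tower]; ring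

theorem height_tower (a : α) {N x : ℕ} (hx : x ≤ N) : height (tower a N) x = x := by
  rw [tower, height_append_left (by simpa using hx), height, openCount, List.take_replicate,
    min_eq_left hx, List.countP_replicate]
  simp; ring

/-- In the opening half, a fragment of length `8k` contains every period `p ≤ 4k` twice, and the
height rises by `p` along it. -/
theorem phrases_tower (a : α) {k N : ℕ} (hk : 0 < k) (m : ℕ) (h : 8 * k * m ≤ N) :
    Phrases k (tower a N) m (8 * k * m) := by
  induction m with
  | zero => exact .zero
  | succ m ih =>
    rw [mul_add, mul_one] at h ⊢
    refine (ih (by omega)).succ (by omega) (by rw [length_tower]; omega) ?_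
    rintro ⟨p, hp, hpk, -, hb⟩
    have := hb (by omega)
    rw [height_tower a (by omega), height_tower a (by omega)] at this
    push_cast at this
    omega

theorem forcesDiagonal_tower (a : α) {k : ℕ} (hk : 0 < k) :
    ForcesDiagonal k (tower a (79 * k ^ 2)) :=
  (phrases_tower a hk (2 * k + 1) (by nlinarith)).forcesDiagonal (isForest_tower _ _) (by omega)

end

section
variable {α : Type*}

/-! ### The scan for phrases -/

/-- Two periods of a fragment that is at least as long as their sum have proportional height
differences. -/
theorem PeriodicOn.height_proportional {P : List (Paren α)} {l p q r : ℕ} (hp : 0 < p) (hq : 0 < q)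
    (h : PeriodicOn P l r p) (h' : PeriodicOn P l r q) (hpq : l + p + q ≤ r) (hr : r ≤ P.length) :
    (q : ℤ) * (height P (l + p) - height P l) = p * (height P (l + q) - height P l) := by
  induction hn : p + q using Nat.strong_induction_on generalizing p q r with
  | _ n ih =>
    -- Euclid's algorithm: `q - p` is a period of the fragment shortened by `p`, and height changes
    -- over adjacent windows add up.
    have step : ∀ {p q r : ℕ}, 0 < p → p < q → PeriodicOn P l r p → PeriodicOn P l r q →
        l + p + q ≤ r → r ≤ P.length → p + q = n →
        (q : ℤ) * (height P (l + p) - height P l) = p * (height P (l + q) - height P l) := by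
      intro p q r hp hlt h h' hpq hr hn
      obtain ⟨d, rfl⟩ : ∃ d, q = p + d := ⟨q - p, by omega⟩
      have h1 : PeriodicOn P l (r - p) d := by
        intro x hx hxr
        rw [h' x hx (by omega), h (x + d) (by omega) (by omega)]
        congr 1; ring
      have h2 := ih (p + d) (by omega) hp (by omega) (h.mono le_rfl (by omega)) h1 (by omega)
        (by omega) rfl
      have h3 := h.height_eq hr (l + d) (by omega) (by omega)
      rw [show l + d + p = l + (p + d) by ring] at h3
      push_cast
      linear_combination h2 - (p : ℤ) * h3
    rcases lt_trichotomy p q with hlt | rfl | hgt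
    · exact step hp hlt h h' hpq hr hn
    · rfl
    · exact (step hq hgt h' h (by omega) hr (by omega)).symm

/-! ### The invariant of the scan -/

/-- The state of the scan: the prefix `P[0 .. i)` is divided into `cnt` phrases, the current phrase
has been read up to position `i + j`, the candidate for the shortest period of the next prefix of
this phrase is `j - b`, and `tab` is the border table of its prefixes of lengths up to `8k`. -/
structure ScanInv (k : ℕ) (P : List (Paren α)) (i j b cnt : ℕ) (tab : ℕ → ℕ) : Prop where
  pos : 1 ≤ j
  lt : b < j
  -- A new phrase counts its first character as read at once, so the position may exceed the end by
  -- one.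
  le : i + j ≤ P.length + 1
  phrases : Phrases k P cnt i
  red_le : redCount k P 0 i ≤ cnt * (42 * k + 1)
  periodic : PeriodicOn P i (i + j) (j - b)
  table : ∀ m, 1 ≤ m → m ≤ j → m ≤ 8 * k → tab m < m ∧ PeriodicOn P i (i + m) (m - tab m) ∧
    ∀ q, 1 ≤ q → q ≤ m → PeriodicOn P i (i + m) q → m - tab m ≤ q
  -- While the border table is being built, no period shorter than the candidate survives the next
  -- character.
  next : j < 8 * k → ∀ q, 1 ≤ q → q ≤ j → PeriodicOn P i (i + j + 1) q → j - b ≤ q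
  -- Minimality is no longer needed here, only that the candidate is short if any period is.
  full : 8 * k ≤ j → ∀ q, 1 ≤ q → q ≤ 4 * k → PeriodicOn P i (i + j) q → j - b ≤ 4 * k
  long : 8 * k < j → j - b ≤ 4 * k ∧ height P (i + (j - b)) = height P i

variable {k : ℕ} {P : List (Paren α)} {i j b cnt : ℕ} {tab : ℕ → ℕ}

theorem scanInv_init (hk : 0 < k) : ScanInv k P 0 1 0 0 (fun _ => 0) where
  pos := le_rfl
  lt := Nat.one_pos
  le := by omega
  phrases := .zero
  red_le := by simpa using redCount_le_sub k P 0 0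
  periodic := fun x _ h => by omega
  table := fun m h1 h2 _ => ⟨h1, fun x _ h => by omega, fun q _ _ _ => by omega⟩
  next := fun _ q _ _ _ => by omega
  full := fun h => by omega
  long := fun h => by omega

theorem PeriodicOn.extend (h : PeriodicOn P i (i + j) (j - b)) (hb : b < j)
    (heq : P[i + j]? = P[i + b]?) : PeriodicOn P i (i + j + 1) (j - b) := by
  intro x hx hxr
  rcases Nat.lt_or_ge (x + (j - b)) (i + j) with h1 | h1
  · exact h x hx h1
  · obtain rfl : x = i + b := by omega
    rw [← heq]; congr 1; omega

theorem ScanInv.extend_long (h : ScanInv k P i j b cnt tab) (hj : 8 * k ≤ j)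
    (hij : i + j < P.length) (hp : j - b ≤ 4 * k) (hb : height P (i + (j - b)) = height P i)
    (heq : P[i + j]? = P[i + b]?) : ScanInv k P i (j + 1) (b + 1) cnt tab where
  pos := by omega
  lt := by have := h.lt; omega
  le := by omega
  phrases := h.phrases
  red_le := h.red_le
  periodic := by rw [Nat.add_sub_add_right]; exact h.periodic.extend h.lt heq
  table := fun m h1 _ h3 => h.table m h1 (by omega) h3
  next := fun h' => by omega
  full := fun _ q _ _ _ => by omega
  long := fun _ => by rw [Nat.add_sub_add_right]; exact ⟨hp, hb⟩

/-- Suppose that the phrase up to the new character had a short balanced period `q`. Then the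
candidate is short as well, and on the `8k` or more characters before it both periods fit side by
side. Hence the candidate is balanced and predicts the same next character, so it would have passed
all three tests. -/
theorem ScanInv.finish (hk : 0 < k) (h : ScanInv k P i j b cnt tab) (hj : 8 * k ≤ j)
    (hij : i + j < P.length) (hbad : ¬ (j - b ≤ 4 * k ∧ height P (i + (j - b)) = height P i ∧
      P[i + j]? = P[i + b]?)) : ScanInv k P (i + j + 1) 1 0 (cnt + 1) tab where
  pos := le_rfl
  lt := Nat.one_pos
  le := by omega
  phrases := by
    refine h.phrases.succ (by omega) (by omega) ?_
    rintro ⟨q, hq1, hq2, hq, hqb⟩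
    have hlt := h.lt
    have hp := h.full hj q hq1 hq2 (hq.mono le_rfl (by omega))
    refine hbad ⟨hp, ?_, ?_⟩
    · have h1 := h.periodic.height_proportional (by omega) hq1 (hq.mono le_rfl (by omega))
        (by omega) (by omega)
      rw [hqb (by omega), sub_self, mul_zero, mul_eq_zero] at h1
      rcases h1 with h1 | h1 <;> omega
    · obtain ⟨x, hx⟩ : ∃ x, i + j = x + q + (j - b) := ⟨i + j - q - (j - b), by omega⟩
      have e1 := hq (x + (j - b)) (by omega) (by omega)
      have e2 := h.periodic x (by omega) (by omega)
      have e3 := hq x (by omega) (by omega)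
      rw [show i + j = x + (j - b) + q by omega, ← e1, ← e2, e3]
      congr 1; omega
  red_le := by
    have e0 := h.red_le
    have e1 := redCount_le_add k P 0 i (i + j + 1)
    have e2 := redCount_le_add k P i (i + j) (i + j + 1)
    have e3 := redCount_le_sub k P (i + j) (i + j + 1)
    have e4 : redCount k P i (i + j) ≤ 42 * k := by
      rcases hj.eq_or_lt with hj | hj
      · have := redCount_le_sub k P i (i + j); omega
      · have hlt := h.lt
        obtain ⟨h1, h2⟩ := h.long hj
        exact ShortBalancedPeriod.redCount_le ⟨j - b, by omega, h1, h.periodic, fun _ => h2⟩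
          (by omega)
    rw [add_mul]; omega
  periodic := fun x _ h => by omega
  -- The table need not be cleared: only the entry for length `1` is claimed now, and it is `0` in
  -- any phrase.
  table := fun m h1 h2 h3 => by
    obtain rfl : m = 1 := by omega
    have := (h.table 1 le_rfl h.pos h3).1
    exact ⟨this, fun x _ h => by omega, fun q _ _ _ => by omega⟩
  next := fun _ q _ _ _ => by omega
  full := fun h => by omega
  long := fun h => by omega

theorem ScanInv.extend (h : ScanInv k P i j b cnt tab) (hj : j < 8 * k)
    (hij : i + j < P.length) (heq : P[i + j]? = P[i + b]?) :
    ScanInv k P i (j + 1) (b + 1) cnt (Function.update tab (j + 1) (b + 1)) where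
  pos := by omega
  lt := by have := h.lt; omega
  le := by omega
  phrases := h.phrases
  red_le := h.red_le
  periodic := by rw [Nat.add_sub_add_right]; exact h.periodic.extend h.lt heq
  table := fun m h1 h2 h3 => by
    have hlt := h.lt
    rcases h2.eq_or_lt with rfl | h2
    · rw [Function.update_self, Nat.add_sub_add_right]
      refine ⟨by omega, h.periodic.extend h.lt heq, fun q hq1 hq2 hq => ?_⟩
      rcases hq2.eq_or_lt with rfl | hq2
      · omega
      · exact h.next hj q hq1 (by omega) hq
    · rw [Function.update_of_ne (by omega)]
      exact h.table m h1 (by omega) h3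
  next := fun _ q hq1 hq2 hq => by
    rw [Nat.add_sub_add_right]
    rcases hq2.eq_or_lt with rfl | hq2
    · omega
    · exact h.next hj q hq1 (by omega) (hq.mono le_rfl (by omega))
  full := fun _ q hq1 hq2 hq => by
    rw [Nat.add_sub_add_right]
    exact (h.next hj q hq1 (by omega) hq).trans hq2
  long := fun h => by omega

theorem PeriodicOn.eq_of_le {r q : ℕ} (h : PeriodicOn P i (r + 1) q) (hq : i + q ≤ r) :
    P[r]? = P[r - q]? := by
  rw [h (r - q) (by omega) (by omega)]; congr 1; omega

theorem ScanInv.extend_zero (h : ScanInv k P i j 0 cnt tab) (hj : j < 8 * k)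
    (hij : i + j < P.length) (hne : P[i + j]? ≠ P[i]?) :
    ScanInv k P i (j + 1) 0 cnt (Function.update tab (j + 1) 0) := by
  have key : ∀ q, 1 ≤ q → q ≤ j + 1 → PeriodicOn P i (i + j + 1) q → j + 1 ≤ q := by
    intro q hq1 hq2 hq
    by_contra hlt
    have h1 := h.next hj q hq1 (by omega) hq
    obtain rfl : q = j := by omega
    exact hne (by simpa using hq.eq_of_le (by omega))
  exact
  { pos := by omega
    lt := by omega
    le := by omega
    phrases := h.phrases
    red_le := h.red_le
    periodic := fun x _ h => by omega
    table := fun m h1 h2 h3 => by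
      rcases h2.eq_or_lt with rfl | h2
      · rw [Function.update_self]
        exact ⟨by omega, fun x _ h => by omega, fun q hq1 hq2 hq => key q hq1 hq2 hq⟩
      · rw [Function.update_of_ne (by omega)]
        exact h.table m h1 (by omega) h3
    next := fun _ q hq1 hq2 hq => key q hq1 hq2 (hq.mono le_rfl (by omega))
    full := fun _ q hq1 hq2 hq => by
      have := key q hq1 (by omega) hq; omega
    long := fun h => by omega }

/-- With `p = j - b`, a period `q > p` of the extended fragment gives the period `q - p` of its
prefix of length `b`. The least such period is `b - tab b`, so the next candidate is `j - tab b`;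
the candidate `p` itself is refuted by the mismatch. -/
theorem ScanInv.fall_back (h : ScanInv k P i j b cnt tab) (hj : j < 8 * k)
    (hb : 0 < b) (hne : P[i + j]? ≠ P[i + b]?) :
    ScanInv k P i j (tab b) cnt tab := by
  have hlt := h.lt
  obtain ⟨h1, h2, h3⟩ := h.table b hb hlt.le (by omega)
  exact
  { pos := h.pos
    lt := by omega
    le := h.le
    phrases := h.phrases
    red_le := h.red_le
    periodic := fun x hx hxr => by
      rw [h2 x hx (by omega), h.periodic (x + (b - tab b)) (by omega) (by omega)]
      congr 1; omega
    table := h.table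
    next := fun _ q hq1 hq2 hq => by
      have h4 := h.next hj q hq1 hq2 hq
      rcases h4.eq_or_lt with rfl | h4
      · refine absurd (hq.eq_of_le (by omega)) ?_
        rwa [show i + j - (j - b) = i + b by omega]
      · have := h3 (q - (j - b)) (by omega) (by omega) fun x hx hxr => by
          rw [hq x hx (by omega), h.periodic (x + (q - (j - b))) (by omega) (by omega)]
          congr 1; omega
        omega
    full := fun h => by omega
    long := fun h => by omega }

theorem ScanInv.card_red_le (h : ScanInv k P i j b cnt tab) (hij : P.length ≤ i + j) :
    (red k P).card ≤ (cnt + 1) * (42 * k + 1) := by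
  rw [card_red_eq]
  have e0 := h.red_le
  have e1 := redCount_le_add k P 0 i P.length
  have e2 : redCount k P i P.length ≤ 42 * k := by
    rcases Nat.lt_or_ge (8 * k) j with hj | hj
    · have hlt := h.lt
      obtain ⟨h1, h2⟩ := h.long hj
      exact ShortBalancedPeriod.redCount_le
        ⟨j - b, by omega, h1, h.periodic.mono le_rfl hij, fun _ => h2⟩ le_rfl
    · have := redCount_le_sub k P i P.length
      omega
  rw [add_mul]; omega

end

/-! ### Reasoning about programs -/

theorem Ex.Fits.mono {W W' : ℕ} (hW : W ≤ W') {s : Memory} {e : Ex} (h : e.Fits W s) :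
    e.Fits W' s := by
  induction e with
  | const n => exact lt_of_lt_of_le h hW
  | var x => exact lt_of_lt_of_le h hW
  | read a i ih => exact ⟨ih h.1, h.2.trans_le hW⟩
  | add e f ihe ihf => exact ⟨ihe h.1, ihf h.2.1, h.2.2.trans_le hW⟩
  | sub e f ihe ihf => exact ⟨ihe h.1, ihf h.2⟩
  | mul e f ihe ihf => exact ⟨ihe h.1, ihf h.2.1, h.2.2.trans_le hW⟩

theorem Exec.mono {W W' : ℕ} (hW : W ≤ W') {c : Prog} {s s' : Memory} {t : ℕ}
    (h : Exec W c s t s') : Exec W' c s t s' := by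
  induction h with
  | skip s => exact .skip s
  | assign s x e he => exact .assign s x e (he.mono hW)
  | write s a i e hi he => exact .write s a i e (hi.mono hW) (he.mono hW)
  | seq _ _ ih1 ih2 => exact .seq ih1 ih2
  | ite_true he h _ ih => exact .ite_true (he.mono hW) h ih
  | ite_false he h _ ih => exact .ite_false (he.mono hW) h ih
  | while_false he h => exact .while_false (he.mono hW) h
  | while_true he h _ _ ih1 ih2 => exact .while_true (he.mono hW) h ih1 ih2

/-- The program `c` halts within `T` units of time, and its final memory satisfies `Q`. -/
def Runs (W : ℕ) (c : Prog) (T : ℕ) (s : Memory) (Q : Memory → Prop) : Prop :=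
  ∃ t s', t ≤ T ∧ Exec W c s t s' ∧ Q s'

/-- Weakest preconditions of programs without loops. -/
def Prog.wp (W : ℕ) : Prog → (Memory → Prop) → Memory → Prop
  | .skip, Q, s => Q s
  | .assign x e, Q, s => e.Fits W s ∧ Q (s.setVar x (e.val s))
  | .write a i e, Q, s => i.Fits W s ∧ e.Fits W s ∧ Q (s.setArr a (i.val s) (e.val s))
  | .seq c d, Q, s => c.wp W (d.wp W Q) s
  | .ite e c d, Q, s => e.Fits W s ∧ (e.val s ≠ 0 → c.wp W Q s) ∧ (e.val s = 0 → d.wp W Q s)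
  | .while _ _, _, _ => False

/-- An upper bound on the running time of a program without loops. -/
def Prog.bound : Prog → ℕ
  | .skip => 1
  | .assign _ e => e.time + 1
  | .write _ i e => i.time + e.time + 1
  | .seq c d => c.bound + d.bound
  | .ite e c d => e.time + (c.bound + d.bound) + 1
  | .while _ _ => 0

variable {W : ℕ}

theorem Runs.of_wp {c : Prog} : ∀ {Q : Memory → Prop} {s : Memory}, c.wp W Q s →
    Runs W c c.bound s Q := by
  induction c with
  | skip => exact fun h => ⟨1, _, le_rfl, .skip _, h⟩
  | assign x e => exact fun h => ⟨_, _, le_rfl, .assign _ _ _ h.1, h.2⟩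
  | write a i e => exact fun h => ⟨_, _, le_rfl, .write _ _ _ _ h.1 h.2.1, h.2.2⟩
  | seq c d ihc ihd =>
    intro Q s h
    obtain ⟨t, s', ht, he, hs'⟩ := ihc h
    obtain ⟨t', s'', ht', he', hs''⟩ := ihd hs'
    exact ⟨_, _, add_le_add ht ht', .seq he he', hs''⟩
  | ite e c d ihc ihd =>
    intro Q s h
    by_cases hv : e.val s = 0
    · obtain ⟨t, s', ht, he, hs'⟩ := ihd (h.2.2 hv)
      exact ⟨_, _, by simp only [Prog.bound]; omega, .ite_false h.1 hv he, hs'⟩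
    · obtain ⟨t, s', ht, he, hs'⟩ := ihc (h.2.1 hv)
      exact ⟨_, _, by simp only [Prog.bound]; omega, .ite_true h.1 hv he, hs'⟩
  | _ => exact fun h => h.elim

theorem Runs.mono {c : Prog} {T T' : ℕ} {s : Memory} {Q Q' : Memory → Prop}
    (h : Runs W c T s Q) (hT : T ≤ T') (hQ : ∀ s', Q s' → Q' s') : Runs W c T' s Q' :=
  let ⟨t, s', ht, he, hs⟩ := h
  ⟨t, s', ht.trans hT, he, hQ _ hs⟩

theorem Runs.mono_time {c : Prog} {T T' : ℕ} {s : Memory} {Q : Memory → Prop}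
    (h : Runs W c T s Q) (hT : T ≤ T') : Runs W c T' s Q :=
  h.mono hT fun _ h => h

theorem Runs.seq {c d : Prog} {T T' : ℕ} {s : Memory} {Q Q' : Memory → Prop}
    (h : Runs W c T s Q) (h' : ∀ s', Q s' → Runs W d T' s' Q') :
    Runs W (.seq c d) (T + T') s Q' := by
  obtain ⟨t, s', ht, he, hs'⟩ := h
  obtain ⟨t', s'', ht', he', hs''⟩ := h' s' hs'
  exact ⟨_, _, add_le_add ht ht', .seq he he', hs''⟩

theorem Runs.ite {e : Ex} {c d : Prog} {T : ℕ} {s : Memory} {Q : Memory → Prop}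
    (hf : e.Fits W s) (hc : e.val s ≠ 0 → Runs W c T s Q) (hd : e.val s = 0 → Runs W d T s Q) :
    Runs W (.ite e c d) (e.time + T + 1) s Q := by
  by_cases hv : e.val s = 0
  · obtain ⟨t, s', ht, he, hs'⟩ := hd hv
    exact ⟨_, _, by omega, .ite_false hf hv he, hs'⟩
  · obtain ⟨t, s', ht, he, hs'⟩ := hc hv
    exact ⟨_, _, by omega, .ite_true hf hv he, hs'⟩

/-- Loops with an invariant `I` and a decreasing potential `f`. -/
theorem Runs.loop {e : Ex} {c : Prog} (I : Memory → Prop) (f : Memory → ℕ) {B : ℕ}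
    (hf : ∀ s, I s → e.Fits W s)
    (hc : ∀ s, I s → e.val s ≠ 0 → Runs W c B s (fun s' => I s' ∧ f s' < f s)) {s : Memory}
    (hs : I s) : Runs W (.while e c) (f s * (B + e.time + 1) + e.time + 1) s
      (fun s' => I s' ∧ e.val s' = 0) := by
  induction hn : f s using Nat.strong_induction_on generalizing s with
  | _ n ih =>
    by_cases hv : e.val s = 0
    · exact ⟨_, _, by omega, .while_false (hf s hs) hv, hs, hv⟩
    · obtain ⟨t, s', ht, he, hs', hlt⟩ := hc s hs hv
      obtain ⟨t', s'', ht', he', hs''⟩ := ih (f s') (by omega) hs' rfl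
      refine ⟨_, _, ?_, .while_true (hf s hs) hv he he', hs''⟩
      have h1 : (f s' + 1) * (B + e.time + 1) ≤ n * (B + e.time + 1) :=
        Nat.mul_le_mul_right _ (by omega)
      rw [add_mul] at h1
      omega

/-! ### The program -/

/-- An expression that vanishes if and only if `e` and `f` have the same value. -/
def Ex.differ (e f : Ex) : Ex := .add (.sub e f) (.sub f e)

/-- Array `5` receives the numbers of opening parentheses in the prefixes of the input. -/
def countLoop : Prog :=
  .while (.sub (.var 0) (.var 7))
    (.seq (.write 5 (.add (.var 7) (.const 1)) (.add (.read 5 (.var 7)) (.read 1 (.var 7))))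
      (.assign 7 (.add (.var 7) (.const 1))))

/-- Nonzero if the characters at positions `var 3 + var 4` and `var 3 + var 5` differ. -/
def mismatch : Ex :=
  .add
    (Ex.differ (.read 0 (.add (.var 3) (.var 4))) (.read 0 (.add (.var 3) (.var 5))))
    (Ex.differ (.read 1 (.add (.var 3) (.var 4))) (.read 1 (.add (.var 3) (.var 5))))

/-- Nonzero if the period `var 4 - var 5` is too long, or not balanced, or ends here. -/
def badPeriod : Ex :=
  .add (.sub (.sub (.var 4) (.var 5)) (.mul (.const 4) (.var 1)))
    (.add
      (Ex.differ
        (.mul (.const 2) (.sub (.read 5 (.add (.var 3) (.sub (.var 4) (.var 5))))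
          (.read 5 (.var 3))))
        (.sub (.var 4) (.var 5)))
      mismatch)

/-- One step of the scan. -/
def scanBody : Prog :=
  -- The truncated difference is nonzero exactly if `8k ≤ j`, when the table is complete.
  .ite (.sub (.add (.var 4) (.const 1)) (.mul (.const 8) (.var 1)))
    (.ite badPeriod
      (.seq (.assign 3 (.add (.add (.var 3) (.var 4)) (.const 1)))
        (.seq (.assign 4 (.const 1))
          (.seq (.assign 5 (.const 0)) (.assign 6 (.add (.var 6) (.const 1))))))
      (.seq (.assign 4 (.add (.var 4) (.const 1))) (.assign 5 (.add (.var 5) (.const 1)))))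
    (.ite mismatch
      (.ite (.var 5)
        (.assign 5 (.read 4 (.var 5)))
        (.seq (.assign 4 (.add (.var 4) (.const 1))) (.write 4 (.var 4) (.const 0))))
      (.seq (.assign 4 (.add (.var 4) (.const 1)))
        (.seq (.assign 5 (.add (.var 5) (.const 1))) (.write 4 (.var 4) (.var 5)))))

/-- The scan for phrases; variable `6` receives their number. -/
def scanLoop : Prog := .while (.sub (.var 0) (.add (.var 3) (.var 4))) scanBody

/-- The output is a tower of height `var 8`. -/
def towerBody : Prog :=
  .seq (.write 2 (.var 7) (.read 0 (.const 0)))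
    (.seq (.write 3 (.var 7) (.const 1))
      (.seq (.write 2 (.add (.var 8) (.var 7)) (.read 0 (.const 0)))
        (.seq (.write 3 (.add (.var 8) (.var 7)) (.const 0))
          (.assign 7 (.add (.var 7) (.const 1))))))

/-- The output is the input. -/
def copyBody : Prog :=
  .seq (.write 2 (.var 7) (.read 0 (.var 7)))
    (.seq (.write 3 (.var 7) (.read 1 (.var 7))) (.assign 7 (.add (.var 7) (.const 1))))

/-- The kernelization algorithm. -/
def kernelProg : Prog :=
  .seq (.assign 8 (.mul (.const 79) (.mul (.var 1) (.var 1))))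
    (.seq
      -- Inputs shorter than `158k²` skip the scan. The phrase count then stays `0`, so they are
      -- copied, and a tower is written only if it is not longer than the input.
      (.ite (.sub (.mul (.const 2) (.var 8)) (.var 0)) .skip
        (.seq countLoop (.seq (.assign 4 (.const 1)) scanLoop)))
      (.ite (.sub (.var 6) (.mul (.const 2) (.var 1)))
        (.seq (.seq (.assign 7 (.const 0)) (.assign 2 (.mul (.const 2) (.var 8))))
          (.while (.sub (.var 8) (.var 7)) towerBody))
        (.seq (.seq (.assign 7 (.const 0)) (.assign 2 (.var 0)))
          (.while (.sub (.var 0) (.var 7)) copyBody))))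

/-! ### Verification of the program -/

/-- The memory still contains the input. -/
structure HasInput (lab kind : ℕ → ℕ) (n k : ℕ) (s : Memory) : Prop where
  var0 : s.var 0 = n
  var1 : s.var 1 = k
  arr0 : s.arr 0 = lab
  arr1 : s.arr 1 = kind

section
variable {α : Type*} {lab kind : ℕ → ℕ} {P : List (Paren α)} {k M : ℕ}

theorem runs_copy (hW : 1000 * (M + 1) ≤ W) (hn : P.length ≤ M) (hlab : ∀ x, lab x ≤ M)
    (hkind : ∀ x, kind x ≤ 1) {s : Memory} (h : HasInput lab kind P.length k s) :
    Runs W (.seq (.seq (.assign 7 (.const 0)) (.assign 2 (.var 0)))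
          (.while (.sub (.var 0) (.var 7)) copyBody)) (100 * P.length + 100) s
      (fun s' => s'.var 2 = P.length ∧
        ∀ x < P.length, s'.arr 2 x = lab x ∧ s'.arr 3 x = kind x) := by
  obtain ⟨h0, h1, h2, h3⟩ := h
  refine (Runs.seq (Q := fun s => s.var 0 = P.length ∧ s.arr 0 = lab ∧ s.arr 1 = kind ∧
    s.var 2 = P.length ∧ s.var 7 = 0) (Runs.of_wp ?_) (T' := 50 * P.length + 50) ?_).mono ?_
      fun _ h => h
  · simp [Prog.wp, Ex.Fits, Ex.val, Memory.setVar, h0, h2, h3]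
    omega
  · rintro s ⟨h0, h2, h3, h4, h5⟩
    refine (Runs.loop (B := copyBody.bound) (I := fun s => s.var 0 = P.length ∧ s.arr 0 = lab ∧
      s.arr 1 = kind ∧ s.var 2 = P.length ∧ s.var 7 ≤ P.length ∧
      ∀ x < s.var 7, s.arr 2 x = lab x ∧ s.arr 3 x = kind x) (f := fun s => P.length - s.var 7)
      ?_ ?_ (by simp [h0, h2, h3, h4, h5])).mono ?_ ?_
    · rintro s ⟨h0, -, -, -, h5, -⟩
      simp [Ex.Fits, h0]; omega
    · rintro s ⟨h0, h2, h3, h4, h5, h6⟩ hv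
      simp only [Ex.val, h0] at hv
      have hl := hlab (s.var 7)
      have hk := hkind (s.var 7)
      refine Runs.of_wp ?_
      simp [copyBody, Prog.wp, Ex.Fits, Ex.val, Memory.setVar, Memory.setArr,
        Function.update_apply, h0, h2, h3, h4]
      refine ⟨by omega, by omega, by omega, by omega, by omega, ⟨by omega, ?_⟩, by omega⟩
      intro x hx
      by_cases hxe : x = s.var 7
      · simp [hxe]
      · simp [hxe, h6 x (by omega)]
    · simp only [copyBody, Prog.bound, Ex.time, h5]; omega
    · rintro s ⟨⟨h0, h2, h3, h4, h5, h6⟩, hv⟩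
      simp only [Ex.val, h0] at hv
      exact ⟨h4, fun x hx => h6 x (by omega)⟩
  · simp only [Prog.bound, Ex.time]; omega

theorem runs_tower {N : ℕ} (hW : 1000 * (M + 1) ≤ W) (hN : 2 * N ≤ P.length) (hn : P.length ≤ M)
    (hlab : ∀ x, lab x ≤ M) {s : Memory} (h : HasInput lab kind P.length k s)
    (h8 : s.var 8 = N) :
    Runs W (.seq (.seq (.assign 7 (.const 0)) (.assign 2 (.mul (.const 2) (.var 8))))
          (.while (.sub (.var 8) (.var 7)) towerBody)) (100 * P.length + 100) s
      (fun s' => s'.var 2 = 2 * N ∧ ∀ x < N, s'.arr 2 x = lab 0 ∧ s'.arr 3 x = 1 ∧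
        s'.arr 2 (N + x) = lab 0 ∧ s'.arr 3 (N + x) = 0) := by
  obtain ⟨h0, h1, h2, h3⟩ := h
  have hl := hlab 0
  refine (Runs.seq (Q := fun s => s.var 8 = N ∧ s.arr 0 = lab ∧
    s.var 2 = 2 * N ∧ s.var 7 = 0) (Runs.of_wp ?_) (T' := 50 * P.length + 50) ?_).mono ?_
      fun _ h => h
  · simp [Prog.wp, Ex.Fits, Ex.val, Memory.setVar, h8, h2]
    omega
  · rintro s ⟨h0, h2, h4, h5⟩
    refine (Runs.loop (B := towerBody.bound) (I := fun s => s.var 8 = N ∧ s.arr 0 = lab ∧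
      s.var 2 = 2 * N ∧ s.var 7 ≤ N ∧
      ∀ x < s.var 7, s.arr 2 x = lab 0 ∧ s.arr 3 x = 1 ∧
        s.arr 2 (N + x) = lab 0 ∧ s.arr 3 (N + x) = 0) (f := fun s => N - s.var 7)
      ?_ ?_ (by simp [h0, h2, h4, h5])).mono ?_ ?_
    · rintro s ⟨h0, -, -, h5, -⟩
      simp [Ex.Fits, h0]; omega
    · rintro s ⟨h0, h2, h4, h5, h6⟩ hv
      simp only [Ex.val, h0] at hv
      refine Runs.of_wp ?_
      simp [towerBody, Prog.wp, Ex.Fits, Ex.val, Memory.setVar, Memory.setArr,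
        Function.update_apply, h0, h2, h4]
      refine ⟨by omega, by omega, by omega, by omega, by omega, by omega, by omega, by omega,
        by omega, ⟨by omega, ?_⟩, by omega⟩
      intro x hx
      by_cases hxe : x = s.var 7
      · subst hxe
        have : N ≠ 0 := by omega
        simp [this]
      · obtain ⟨h7, h8, h9, h10⟩ := h6 x (by omega)
        have a1 : x ≠ N + s.var 7 := by omega
        have a2 : N + x ≠ s.var 7 := by omega
        simp [hxe, a1, a2, h7, h8, h9, h10]
    · simp only [towerBody, Prog.bound, Ex.time, h5]; omega
    · rintro s ⟨⟨h0, h2, h4, h5, h6⟩, hv⟩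
      simp only [Ex.val, h0] at hv
      exact ⟨h4, fun x hx => h6 x (by omega)⟩
  · simp only [Prog.bound, Ex.time]; omega

end
section
variable {α : Type*} {lab kind : ℕ → ℕ} {P : List (Paren α)} {k M W : ℕ}

theorem runs_count (hW : 1000 * (M + 1) ≤ W) (hn : P.length ≤ M) (hkind1 : ∀ x, kind x ≤ 1)
    (hcount : ∀ x < P.length, openCount P (x + 1) = openCount P x + kind x)
    {s : Memory} (h : HasInput lab kind P.length k s) (h3 : s.var 3 = 0) (h5 : s.var 5 = 0)
    (h6 : s.var 6 = 0) (h7 : s.var 7 = 0) (ha4 : s.arr 4 = fun _ => 0)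
    (ha5 : s.arr 5 = fun _ => 0) :
    Runs W countLoop (50 * P.length + 50) s (fun s' => HasInput lab kind P.length k s' ∧
      s'.var 8 = s.var 8 ∧ s'.var 3 = 0 ∧ s'.var 5 = 0 ∧ s'.var 6 = 0 ∧ s'.arr 4 = (fun _ => 0) ∧
      ∀ x ≤ P.length, s'.arr 5 x = openCount P x) := by
  refine (Runs.loop (I := fun s' => HasInput lab kind P.length k s' ∧
      s'.var 8 = s.var 8 ∧ s'.var 3 = 0 ∧ s'.var 5 = 0 ∧ s'.var 6 = 0 ∧ s'.arr 4 = (fun _ => 0) ∧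
      s'.var 7 ≤ P.length ∧ ∀ x ≤ s'.var 7, s'.arr 5 x = openCount P x)
    (f := fun s => P.length - s.var 7) (B := 30) ?_ ?_
    ⟨h, rfl, h3, h5, h6, ha4, by omega, by simp [h7, ha5, openCount]⟩).mono ?_ ?_
  · rintro s ⟨⟨h0, -⟩, -, -, -, -, -, h7, -⟩
    simp [Ex.Fits, h0]; omega
  · rintro s' ⟨⟨h0, h1, h2, h2'⟩, h8, h3, h5, h6, ha4, h7, h9⟩ hv
    simp only [Ex.val, h0] at hv
    have e1 := hkind1 (s'.var 7)
    have e2 := h9 _ le_rfl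
    have e3 := openCount_le P (s'.var 7)
    have e4 := hcount (s'.var 7) (by omega)
    refine (Runs.of_wp (Q := fun s₁ => _) ?_).mono (by decide) fun _ h => h
    refine ⟨?_, ?_, ?_, ⟨⟨?_, ?_, ?_, ?_⟩, ?_, ?_, ?_, ?_, ?_, ?_, ?_⟩, ?_⟩
    all_goals simp [Ex.Fits, Ex.val, Memory.setVar, Memory.setArr, h0, h1, h2, h2', h3, h5, h6, h8,
      ha4, e2]
    all_goals try omega
    intro x hx
    by_cases hxe : x = s'.var 7 + 1
    · simp [hxe, e4]
    · simp [hxe, h9 x (by omega)]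
  · simp only [h7, Ex.time]; omega
  · rintro s' ⟨⟨h, h8, h3, h5, h6, ha4, h7, h9⟩, hv⟩
    simp only [Ex.val, h.var0] at hv
    exact ⟨h, h8, h3, h5, h6, ha4, fun x hx => h9 x (by omega)⟩

/-- Phrases are nonempty; this keeps the counter within a machine word. -/
theorem Phrases.count_le (hk : 0 < k) {m i : ℕ} (h : Phrases k P m i) : m ≤ i := by
  induction h with
  | zero => exact le_rfl
  | @succ m i r h hir hr hP ih =>
    rcases hir.eq_or_lt with rfl | hlt
    · exact absurd ⟨1, le_rfl, by omega, fun x _ h => by omega, fun h => by omega⟩ hP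
    · omega

theorem mismatch_fits {s : Memory} {i j b : ℕ} (hW : 1000 * (M + 1) ≤ W) (h2 : s.arr 0 = lab)
    (h3 : s.arr 1 = kind) (hlab : ∀ x, lab x ≤ M) (hkind : ∀ x, kind x ≤ 1)
    (hM : i + j ≤ M ∧ i + b ≤ M) (hi : s.var 3 = i) (hj : s.var 4 = j) (hb : s.var 5 = b) :
    mismatch.Fits W s := by
  have l1 := hlab (i + j)
  have l2 := hlab (i + b)
  have k1 := hkind (i + j)
  have k2 := hkind (i + b)
  simp [mismatch, Ex.differ, Ex.Fits, Ex.val, h2, h3, hi, hj, hb]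
  omega

theorem mismatch_val_le {s : Memory} {i j b : ℕ} (h2 : s.arr 0 = lab)
    (h3 : s.arr 1 = kind) (hlab : ∀ x, lab x ≤ M) (hkind : ∀ x, kind x ≤ 1)
    (hi : s.var 3 = i) (hj : s.var 4 = j) (hb : s.var 5 = b) : mismatch.val s ≤ 2 * M + 2 := by
  have l1 := hlab (i + j)
  have l2 := hlab (i + b)
  have k1 := hkind (i + j)
  have k2 := hkind (i + b)
  simp [mismatch, Ex.differ, Ex.val, h2, h3, hi, hj, hb]
  omega

theorem mismatch_val {s : Memory} {i j b : ℕ} (h2 : s.arr 0 = lab) (h3 : s.arr 1 = kind)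
    (heq : ∀ x < P.length, ∀ y < P.length, (P[x]? = P[y]? ↔ lab x = lab y ∧ kind x = kind y))
    (hij : i + j < P.length) (hib : i + b < P.length)
    (hi : s.var 3 = i) (hj : s.var 4 = j) (hb : s.var 5 = b) :
    mismatch.val s = 0 ↔ P[i + j]? = P[i + b]? := by
  rw [heq _ hij _ hib]
  simp only [mismatch, Ex.differ, Ex.val, h2, h3, hi, hj, hb]
  omega

theorem badPeriod_fits {s : Memory} {i j b : ℕ} (hW : 1000 * (M + 1) ≤ W) (hn : P.length ≤ M)
    (hkM : k ≤ M) (h1 : s.var 1 = k) (hO : ∀ x ≤ P.length, s.arr 5 x = openCount P x)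
    (hij : i + j < P.length) (hbj : b < j) (hi : s.var 3 = i) (hj : s.var 4 = j)
    (hb : s.var 5 = b) (hm : mismatch.Fits W s) (hv : mismatch.val s ≤ 2 * M + 2) :
    badPeriod.Fits W s := by
  have o1 := hO (i + (j - b)) (by omega)
  have o2 := hO i (by omega)
  have c1 := openCount_le P (i + (j - b))
  have c2 := openCount_le P i
  generalize openCount P (i + (j - b)) = p at o1 c1
  generalize openCount P i = q at o2 c2
  refine ⟨?_, ⟨?_, hm, ?_⟩, ?_⟩ <;>
    simp [Ex.differ, Ex.Fits, Ex.val, h1, hi, hj, hb, o1, o2] <;> omega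

theorem badPeriod_val {s : Memory} {i j b : ℕ} (h1 : s.var 1 = k)
    (hO : ∀ x ≤ P.length, s.arr 5 x = openCount P x) (hij : i + j < P.length) (hbj : b < j)
    (hi : s.var 3 = i) (hj : s.var 4 = j) (hb : s.var 5 = b)
    (hv : mismatch.val s = 0 ↔ P[i + j]? = P[i + b]?) :
    badPeriod.val s = 0 ↔ (j - b ≤ 4 * k ∧ height P (i + (j - b)) = height P i ∧
        P[i + j]? = P[i + b]?) := by
  have hheight : height P (i + (j - b)) = height P i ↔
      2 * (openCount P (i + (j - b)) - openCount P i) = j - b := by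
    unfold height; push_cast; omega
  rw [← hv, hheight]
  simp only [badPeriod, Ex.differ, Ex.val, h1, hi, hj, hb, hO (i + (j - b)) (by omega),
    hO i (by omega)]
  omega

/-- The invariant of the scan, in terms of the memory. -/
def ScanMemory (lab kind : ℕ → ℕ) (P : List (Paren α)) (k N : ℕ) (s : Memory) : Prop :=
  HasInput lab kind P.length k s ∧ s.var 8 = N ∧ (∀ x ≤ P.length, s.arr 5 x = openCount P x) ∧
    ScanInv k P (s.var 3) (s.var 4) (s.var 5) (s.var 6) (s.arr 4)

theorem runs_scan {N : ℕ} (hW : 1000 * (M + 1) ≤ W) (hn : P.length ≤ M) (hk : 0 < k) (hkM : k ≤ M)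
    (hlab : ∀ x, lab x ≤ M) (hkind1 : ∀ x, kind x ≤ 1)
    (heq : ∀ x < P.length, ∀ y < P.length,
      (P[x]? = P[y]? ↔ lab x = lab y ∧ kind x = kind y))
    {s : Memory} (h : ScanMemory lab kind P k N s) (hs : s.var 3 = 0 ∧ s.var 4 = 1) :
    Runs W scanLoop (1000 * P.length + 1000) s (fun s' => ScanMemory lab kind P k N s' ∧
      P.length ≤ s'.var 3 + s'.var 4) := by
  refine (Runs.loop (I := ScanMemory lab kind P k N)
    -- Amortization: a match raises the border length by one but the position, which counts twice,
    -- by one as well. A fall back leaves the position and lowers the border length.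
    (f := fun s => 2 * P.length + 2 + s.var 5 - 2 * (s.var 3 + s.var 4)) (B := 300) ?_ ?_
    h).mono ?_ ?_
  · rintro s ⟨⟨h0, -⟩, -, -, hinv⟩
    have := hinv.le
    have := hinv.phrases.le
    simp [Ex.Fits, Ex.val, h0]; omega
  · rintro s ⟨⟨h0, h1, h2, h3⟩, h8, hO, hinv⟩ hv
    simp only [Ex.val, h0] at hv
    obtain ⟨i, hi⟩ : ∃ i, s.var 3 = i := ⟨_, rfl⟩
    obtain ⟨j, hj⟩ : ∃ j, s.var 4 = j := ⟨_, rfl⟩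
    obtain ⟨b, hb⟩ : ∃ b, s.var 5 = b := ⟨_, rfl⟩
    obtain ⟨cnt, hcnt⟩ : ∃ cnt, s.var 6 = cnt := ⟨_, rfl⟩
    rw [hi, hj, hb, hcnt] at hinv
    rw [hi, hj] at hv
    have hij : i + j < P.length := by omega
    have hbj := hinv.lt
    have hcle := hinv.phrases.count_le hk
    have fm := mismatch_fits hW h2 h3 hlab hkind1 (by omega) hi hj hb
    have vm := mismatch_val h2 h3 heq hij (by omega) hi hj hb
    have fb := badPeriod_fits hW hn hkM h1 hO hij (by omega) hi hj hb fm
      (mismatch_val_le h2 h3 hlab hkind1 hi hj hb)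
    have vb := badPeriod_val h1 hO hij (by omega) hi hj hb vm
    refine (Runs.of_wp (Q := fun s₁ => _) ?_).mono (by decide) fun _ h => h
    simp only [scanBody, Prog.wp]
    refine ⟨by simp [Ex.Fits, Ex.val, h1, hj]; omega,
      fun hc => ⟨fb, fun hbad => ?_, fun hbad => ?_⟩,
      fun hc => ⟨fm, fun hm => ⟨by simp [Ex.Fits, hb]; omega, fun hb0 => ?_, fun hb0 => ?_⟩,
        fun hm => ?_⟩⟩ <;> simp only [Ex.val, h1, hj] at hc
    · have h' := hinv.finish hk (by omega) hij (mt vb.2 hbad)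
      refine ⟨?_, ?_, ?_, ?_, ⟨⟨?_, ?_, ?_, ?_⟩, ?_, ?_, ?_⟩, ?_⟩
      all_goals simp [Ex.Fits, Ex.val, Memory.setVar, h0, h1, h2, h3, h8, hi, hj, hb, hcnt]
      all_goals first | exact h' | exact hO | omega
    · obtain ⟨b1, b2, b3⟩ := vb.1 hbad
      have h' := hinv.extend_long (by omega) hij b1 b2 b3
      refine ⟨?_, ?_, ⟨⟨?_, ?_, ?_, ?_⟩, ?_, ?_, ?_⟩, ?_⟩
      all_goals simp [Ex.Fits, Ex.val, Memory.setVar, h0, h1, h2, h3, h8, hi, hj, hb, hcnt]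
      all_goals first | exact h' | exact hO | omega
    · simp only [Ex.val, hb] at hb0
      have h' := hinv.fall_back (by omega) (by omega) (mt vm.2 hm)
      have ht := (hinv.table b (by omega) (by omega) (by omega)).1
      refine ⟨?_, ⟨⟨?_, ?_, ?_, ?_⟩, ?_, ?_, ?_⟩, ?_⟩
      all_goals simp [Ex.Fits, Ex.val, Memory.setVar, h0, h1, h2, h3, h8, hi, hj, hb, hcnt]
      all_goals first | exact h' | exact hO | omega
    · simp only [Ex.val, hb] at hb0
      subst hb0
      have h' := hinv.extend_zero (by omega) hij (mt vm.2 hm)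
      refine ⟨?_, ?_, ?_, ⟨⟨?_, ?_, ?_, ?_⟩, ?_, ?_, ?_⟩, ?_⟩
      all_goals simp [Ex.Fits, Ex.val, Memory.setVar, Memory.setArr, h0, h1, h2, h3, h8, hi, hj, hb,
        hcnt]
      all_goals first | exact h' | exact hO | omega
    · have h' := hinv.extend (by omega) hij (vm.1 hm)
      refine ⟨?_, ?_, ?_, ?_, ⟨⟨?_, ?_, ?_, ?_⟩, ?_, ?_, ?_⟩, ?_⟩
      all_goals simp [Ex.Fits, Ex.val, Memory.setVar, Memory.setArr, h0, h1, h2, h3, h8, hi, hj, hb,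
        hcnt]
      all_goals first | exact h' | exact hO | omega
  · have := h.2.2.2.lt
    simp only [hs, Ex.time]
    rw [hs.2] at this
    omega
  · rintro s' ⟨h, hv⟩
    simp only [Ex.val, h.1.var0] at hv
    exact ⟨h, by omega⟩

end
-- Correctness of the whole program
section
variable {α : Type*} {P : List (Paren α)} {k M W : ℕ}

theorem runs_kernel (code : α → ℕ) (hW : 1000 * (M + 1) ≤ W) (hkW : 158 * (k * k) < W)
    (hn : P.length ≤ M) (hk : 0 < k) (hkM : k ≤ M) (hcode : ∀ x ∈ P, code x.label ≤ M)
    (hP : IsForest P) (hinj : ∀ x ∈ P, ∀ y ∈ P, code x.label = code y.label → x.label = y.label) :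
    Runs W kernelProg (2000 * (P.length + 1)) (inputMemory code P k) (fun s =>
      (IsOutput code P s ∧ (red k P).card ≤ 158 * k ^ 2) ∨
      ∃ x ∈ P, IsOutput code (tower x.label (79 * k ^ 2)) s ∧ 158 * k ^ 2 ≤ P.length ∧
        ForcesDiagonal k P) := by
  obtain ⟨lab, hlabdef⟩ : ∃ lab, lab = (inputMemory code P k).arr 0 := ⟨_, rfl⟩
  obtain ⟨kind, hkinddef⟩ : ∃ kind, kind = (inputMemory code P k).arr 1 := ⟨_, rfl⟩
  have hlabx : ∀ x (hx : x < P.length), lab x = code P[x].label := by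
    intro x hx; simp [hlabdef, inputMemory, hx]
  have hkindx : ∀ x (hx : x < P.length), kind x = P[x].isOpen.toNat := by
    intro x hx; simp [hkinddef, inputMemory, hx]
  have hlab : ∀ x, lab x ≤ M := by
    intro x
    by_cases hx : x < P.length
    · rw [hlabx x hx]; exact hcode _ (List.getElem_mem hx)
    · simp [hlabdef, inputMemory, List.getElem?_eq_none (not_lt.1 hx)]
  have hkind : ∀ x, kind x ≤ 1 := by
    intro x
    by_cases hx : x < P.length
    · rw [hkindx x hx]; exact Bool.toNat_le _
    · simp [hkinddef, inputMemory, List.getElem?_eq_none (not_lt.1 hx)]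
  have hcount : ∀ x < P.length, openCount P (x + 1) = openCount P x + kind x := by
    intro x hx
    rw [hkindx x hx, openCount_succ (List.getElem?_eq_getElem hx)]
  have heq : ∀ x < P.length, ∀ y < P.length,
      (P[x]? = P[y]? ↔ lab x = lab y ∧ kind x = kind y) := by
    intro x hx y hy
    rw [hlabx x hx, hlabx y hy, hkindx x hx, hkindx y hy, List.getElem?_eq_getElem hx,
      List.getElem?_eq_getElem hy, Option.some_inj]
    refine ⟨fun h => by rw [h]; simp, fun h => Paren.ext' ?_
      (hinj _ (List.getElem_mem hx) _ (List.getElem_mem hy) h.1)⟩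
    have := h.2
    revert this
    cases P[x].isOpen <;> cases P[y].isOpen <;> simp
  have hsq : 158 * k ^ 2 = 2 * (79 * (k * k)) := by ring
  refine (Runs.seq (T := 6) (T' := 1900 * P.length + 1900) (Q := fun s =>
    HasInput lab kind P.length k s ∧ s.var 8 = 79 * (k * k) ∧ s.var 3 = 0 ∧ s.var 5 = 0 ∧
      s.var 6 = 0 ∧ s.var 7 = 0 ∧ s.arr 4 = (fun _ => 0) ∧ s.arr 5 = fun _ => 0)
    ((Runs.of_wp ?_).mono_time (by decide)) ?_).mono_time (by linarith)
  · refine ⟨?_, ⟨?_, ?_, ?_, ?_⟩, ?_, ?_, ?_, ?_, ?_, ?_, ?_⟩ <;>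
      simp [Ex.Fits, Ex.val, Memory.setVar, inputMemory, hlabdef, hkinddef]
    omega
  rintro s ⟨hin, h8, h3, h5, h6, h7, ha4, ha5⟩
  refine (Runs.seq (T := 1200 * P.length + 1200) (T' := 100 * P.length + 200) (Q := fun s =>
    HasInput lab kind P.length k s ∧ s.var 8 = 79 * (k * k) ∧ s.var 6 ≤ M ∧
    (s.var 6 ≤ 2 * k → (red k P).card ≤ 158 * k ^ 2) ∧
    (2 * k < s.var 6 → 158 * k ^ 2 ≤ P.length ∧ ∃ i, Phrases k P (s.var 6) i)) ?_ ?_).mono_time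
    (by omega)
  · refine (Runs.ite (T := 1100 * P.length + 1100) ?_ (fun hc => ?_) (fun hc => ?_)).mono_time
      (by simp [Ex.time]; linarith)
    · simp [Ex.Fits, Ex.val, h8, hin.var0]; omega
    · simp only [Ex.val, h8, hin.var0] at hc
      refine (Runs.of_wp (c := .skip) (Q := fun s => _) ?_).mono_time (by simp [Prog.bound])
      refine ⟨hin, h8, by omega, fun _ => ?_, fun h => by omega⟩
      exact (card_red_le k P).trans (by omega)
    · simp only [Ex.val, h8, hin.var0] at hc
      refine (Runs.seq (runs_count hW hn hkind hcount hin h3 h5 h6 h7 ha4 ha5)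
        (T' := 1002 + 1000 * P.length) ?_).mono_time (by omega)
      rintro s' ⟨hin', h8', h3', h5', h6', ha4', ha5'⟩
      refine (Runs.seq (Q := fun s => ScanMemory lab kind P k (79 * (k * k)) s ∧
        s.var 3 = 0 ∧ s.var 4 = 1) ((Runs.of_wp ?_).mono_time (T' := 2) (by decide))
        (fun s'' h => runs_scan hW hn hk hkM hlab hkind heq h.1 h.2)).mono (by linarith) ?_
      · refine ⟨?_, ⟨⟨?_, ?_, ?_, ?_⟩, ?_, ?_, ?_⟩, ?_, ?_⟩
        all_goals simp [Ex.Fits, Ex.val, Memory.setVar, hin'.var0, hin'.var1, hin'.arr0, hin'.arr1,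
          h8', h8, h3', h5', h6', ha4']
        · omega
        · exact ha5'
        · exact scanInv_init hk
      · rintro s'' ⟨⟨hin'', h8'', -, hinv⟩, hle⟩
        have h1 := hinv.phrases.count_le hk
        have h2 := hinv.phrases.le
        refine ⟨hin'', h8'', by omega, fun h => ?_, fun h => ⟨by omega, _, hinv.phrases⟩⟩
        have h3 := hinv.card_red_le hle
        have h4 : (s''.var 6 + 1) * (42 * k + 1) ≤ (2 * k + 1) * (42 * k + 1) :=
          -- At most `2k` finished phrases and the unfinished rest contribute at most `42k + 1` red
          -- characters each.
          Nat.mul_le_mul_right _ (by omega)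
        nlinarith
  · rintro s ⟨hin, h8, h6, hred, hph⟩
    refine (Runs.ite (T := 100 * P.length + 100) ?_ (fun hc => ?_) (fun hc => ?_)).mono_time
      (by simp [Ex.time]; omega)
    · simp [Ex.Fits, Ex.val, hin.var1]; omega
    · simp only [Ex.val, hin.var1] at hc
      obtain ⟨hlen, i, hi⟩ := hph (by omega)
      refine (runs_tower (N := 79 * (k * k)) hW (by omega) hn hlab hin h8).mono le_rfl ?_
      have hpos : 0 < P.length := by have := Nat.mul_pos hk hk; omega
      rintro s' ⟨hv, hs'⟩
      refine Or.inr ⟨P[0], List.getElem_mem hpos, ⟨?_, ?_⟩, hlen, hi.forcesDiagonal hP (by omega)⟩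
      · rw [hv, length_tower, sq]
      · intro x hx
        rw [length_tower, sq] at hx
        rcases Nat.lt_or_ge x (79 * (k * k)) with hlt | hge
        · obtain ⟨h1, h2, -, -⟩ := hs' x hlt
          rw [h1, h2]
          simp [tower, sq, hlt, hlabx 0 hpos]
        · obtain ⟨y, rfl⟩ := Nat.exists_eq_add_of_le hge
          obtain ⟨-, -, h1, h2⟩ := hs' y (by omega)
          rw [h1, h2]
          simp [tower, sq, hlabx 0 hpos]
    · simp only [Ex.val, hin.var1] at hc
      refine (runs_copy hW hn hlab hkind hin).mono le_rfl fun s' h => Or.inl ⟨⟨h.1, ?_⟩,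
        hred (by omega)⟩
      intro x hx
      rw [← hlabx x hx, ← hkindx x hx]
      exact h.2 x hx

/-- As `M ≥ 1`, the base is at least `3`; ten factors absorb the constants and two remain for the
quadratic terms. -/
theorem word_bounds {M k C : ℕ} (hk : 0 < k) (hkM : k ≤ M) (hC : 12 ≤ C) :
    1000 * (M + 1) ≤ (M + 2) ^ C ∧ 158 * (k * k) < (M + 2) ^ C := by
  have h1 : (M + 2) ^ 12 ≤ (M + 2) ^ C := Nat.pow_le_pow_right (by omega) hC
  have h2 : 3 ^ 10 ≤ (M + 2) ^ 10 := Nat.pow_le_pow_left (by omega) 10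
  have h3 : 3 ^ 10 * (M + 2) ^ 2 ≤ (M + 2) ^ 12 := by
    rw [show (M + 2) ^ 12 = (M + 2) ^ 10 * (M + 2) ^ 2 by ring]
    exact Nat.mul_le_mul_right _ h2
  have h4 : k * k ≤ M * M := Nat.mul_le_mul hkM hkM
  constructor <;> nlinarith

/-- The output must not depend on `M`. It is taken from the run with the least admissible `M`, and
this very run stays valid with larger words. -/
theorem computesInLinearTime_of_runs {c : Prog} {C k : ℕ} {code : α → ℕ} {P : List (Paren α)}
    {Q : List (Paren α) → Prop}
    (h : ∀ M : ℕ, P.length ≤ M → k ≤ M → (∀ x ∈ P, code x.label ≤ M) →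
      Runs ((M + 2) ^ C) c (C * (P.length + 1)) (inputMemory code P k)
        fun s => ∃ P', IsOutput code P' s ∧ Q P') :
    ∃ P', ComputesInLinearTime c C code P k P' ∧ Q P' := by
  have hle : ∀ x ∈ P, code x.label ≤ (P.map fun x => code x.label).foldr max 0 := by
    intro x hx
    exact List.le_max_of_le (List.mem_map_of_mem hx) le_rfl
  obtain ⟨t, s, ht, he, P', hP', hQ⟩ := h
    (max (max P.length k) ((P.map fun x => code x.label).foldr max 0))
    (by simp) (by simp) (fun x hx => (hle x hx).trans (le_max_right _ _))
  refine ⟨P', fun M h1 h2 h3 => ⟨t, s, ht, he.mono (Nat.pow_le_pow_left ?_ _), hP'⟩, hQ⟩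
  have : (P.map fun x => code x.label).foldr max 0 ≤ M := by
    refine List.max_le_of_forall_le _ _ fun y hy => ?_
    obtain ⟨x, hx, rfl⟩ := List.mem_map.1 hy
    exact h3 x hx
  omega

theorem tedEquivalent_refl (k : ℕ) (w : Option α → Option α → ℝ≥0) (P : List (Paren α)) :
    TedEquivalent k w P P := fun _ _ _ _ _ _ _ _ => rfl

end
end TedKernel

/-! ### Assembly of both parts -/

theorem lemma13 :
    (∃ (prog : TedKernel.Prog) (C : ℕ),
      ∀ (α : Type*) (code : α → ℕ) (P : List (TedKernel.Paren α)) (k : ℕ),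
        (∀ x ∈ P, ∀ y ∈ P, code x.label = code y.label → x.label = y.label) →
        TedKernel.IsForest P → 0 < k →
        ∃ P' : List (TedKernel.Paren α),
          TedKernel.ComputesInLinearTime prog C code P k P' ∧
          TedKernel.IsForest P' ∧
          (∀ x ∈ P', ∃ y ∈ P, x.label = y.label) ∧
          P'.length ≤ P.length ∧
          (TedKernel.red k P').card ≤ 158 * k ^ 2 ∧
          ∀ w : Option α → Option α → NNReal,
            TedKernel.Normalized w → TedKernel.IsQuasimetric w →
            TedKernel.TedEquivalent k w P P') ∧
    (∀ (α : Type*) (k : ℕ) (P P' : List (TedKernel.Paren α)), 0 < k →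
      TedKernel.IsForest P → TedKernel.IsForest P' →
      158 * k ^ 2 ≤ (TedKernel.red k P).card → 158 * k ^ 2 ≤ (TedKernel.red k P').card →
      ∀ w : Option α → Option α → NNReal,
        TedKernel.Normalized w → TedKernel.IsQuasimetric w →
        TedKernel.TedEquivalent k w P P') := by
  constructor
  · refine ⟨TedKernel.kernelProg, 2000, fun α code P k hinj hP hk => ?_⟩
    refine TedKernel.computesInLinearTime_of_runs fun M h1 h2 h3 => ?_
    obtain ⟨hW, hkW⟩ := TedKernel.word_bounds hk h2 (C := 2000) (by norm_num)
    refine (TedKernel.runs_kernel code hW hkW h1 hk h2 h3 hP hinj).mono le_rfl ?_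
    rintro s (⟨hs, hred⟩ | ⟨x, hx, hs, hlen, hf⟩)
    · exact ⟨P, hs, hP, fun x hx => ⟨x, hx, rfl⟩, le_rfl, hred,
        fun w _ _ => TedKernel.tedEquivalent_refl k w P⟩
    -- The length of the tower bounds its red characters trivially, so no periodic structure of the
    -- tower is needed.
    · have hl : (TedKernel.tower x.label (79 * k ^ 2)).length = 158 * k ^ 2 := by
        rw [TedKernel.length_tower]; ring
      refine ⟨_, hs, TedKernel.isForest_tower _ _, fun y hy => ⟨x, hx, ?_⟩, by omega,
        hl ▸ TedKernel.card_red_le _ _, fun w hn hq => hf.tedEquivalent hP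
          (TedKernel.isForest_tower _ _) (TedKernel.forcesDiagonal_tower _ hk) hn hq⟩
      rcases List.mem_append.1 hy with hy | hy <;> rw [List.eq_of_mem_replicate hy]
  · intro α k P P' hk hP hP' hred hred' w hn hq
    exact (hP.forcesDiagonal_of_red hk hred).tedEquivalent hP hP'
      (hP'.forcesDiagonal_of_red hk hred') hn hq
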